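/- Conventions. Algebras are associative, unital and finite-dimensional over $\mathbb{R}$. A grading $\Gamma: R=\bigoplus_{g\in G}R_g$ of an algebra $R$ by an abelian group $G$ satisfies $R_gR_h\subseteq R_{gh}$, and $G$ is assumed to be generated by the support $\{g\in G : R_g\neq 0\}$. It is a \emph{division grading} if every nonzero homogeneous element is invertible. A grading $R=\bigoplus_{h\in H}R'_h$ is a \emph{refinement} of $\Gamma$ if every $R'_h$ is contained in some $R_g$, and it is a \emph{proper} refinement if moreover at least one of these containments with $R'_h\ne 0$ is strict; $\Gamma$ is \emph{fine} if no grading of $R$ by an abelian group is a proper refinement of $\Gamma$. Two graded algebras are \emph{equivalent} if there is an algebra isomorphism such that it and its inverse map every homogeneous component into a homogeneous component. The tensor product of a $G$-grading on $R$ and an $H$-grading on $S$ is the $G\times H$-grading $(R\otimes S)_{(g,h)}=R_g\otimes S_h$. For $p,m\ge 0$ let $C(p,m)$ be the Clifford algebra of $q=x_1^2+\dots+x_p^2-x_{p+1}^2-\dots-x_{p+m}^2$ on $\mathbb{R}^{p+m}$ with the convention $v^2=-q(v)$. The graded algebra $C^{\mathrm{gr}}(p,m)$ is $C(p,m)$ graded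 by $\mathbb{Z}_2^{p+m}$ so that the degrees of the standard basis vectors $e_1,\dots,e_{p+m}$ are the standard basis of $\mathbb{Z}_2^{p+m}$ (and $\deg(e_{i_1}\cdots e_{i_l})$ is the sum of the degrees of the factors). Let $M_2^{(4)}$ be $M_2(\mathbb{R})$ graded by $\mathbb{Z}_2\times\mathbb{Z}_2$ with the components $\langle I\rangle,\langle A\rangle,\langle B\rangle,\langle AB\rangle$ in degrees $(0,0),(1,0),(0,1),(1,1)$, where $A=\begin{pmatrix}1&0\\0&-1\end{pmatrix}$, $B=\begin{pmatrix}0&1\\1&0\end{pmatrix}$, and let $\mathbb{H}^{(4)}$ be the quaternion algebra with the components $\langle 1\rangle,\langle i\rangle,\langle j\rangle,\langle k\rangle$ in the same degrees. Proposition. (a) Let $\Gamma$ be a fine division grading by $G$ on a central simple real algebra $R$. Then all components of $\Gamma$ are one-dimensional, $G$ is an elementary abelian 2-group, and one of the following holds: (1) for some $k\ge 0$, $R$ is equivalent to $C^{\mathrm{gr}}(k,k)$ and has the graded presentation $$(x_1,\ldots,x_{2k}\;|\;x_p^2=-1\ (1\le p\le k),\ x_q^2=1\ (k+1\le q\le 2k),\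 x_ux_v=-x_vx_u\ (1\le u<v\le 2k));$$ (2) for some $k\ge 1$, $R$ is equivalent to $C^{\mathrm{gr}}(k+1,k-1)$ and has the graded presentation $$(x_1,\ldots,x_{2k}\;|\;x_p^2=-1\ (1\le p\le k+1),\ x_q^2=1\ (k+2\le q\le 2k),\ x_ux_v=-x_vx_u\ (1\le u<v\le 2k)).$$ Here "has the graded presentation" means: there is a basis $\alpha_1,\ldots,\alpha_{2k}$ of the elementary abelian 2-group $G$ (as a vector space over $\mathbb{Z}_2$) such that the algebra given by the presentation, graded by $\deg x_s=\alpha_s$, is isomorphic to $R$ by an algebra isomorphism that preserves degrees. (b) For every $k\ge 0$, $C^{\mathrm{gr}}(k,k)$ is a fine division grading with one-dimensional components, $C(k,k)\cong M_{2^k}(\mathbb{R})$ as algebras, $C^{\mathrm{gr}}(k,k)$ is equivalent to $(M_2^{(4)})^{\otimes k}$, and it has the graded presentation in (1). (c) For every $k\ge 1$, $C^{\mathrm{gr}}(k+1,k-1)$ is a fine division grading with one-dimensional components, $C(k+1,k-1)\cong M_{2^{k-1}}(\mathbb{H})$ as algebras, $C^{\mathrm{gr}}(k+1,k-1)$ is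 equivalent to $(M_2^{(4)})^{\otimes (k-1)}\otimes\mathbb{H}^{(4)}$, and it has the graded presentation in (2). -/

import Mathlib

open scoped TensorProduct Quaternion

universe u v

/-! ### Gradings, division gradings, fine gradings, equivalence -/

/-- The support of a grading: the set of degrees with a nonzero component. -/
def gradingSupport {G : Type u} {R : Type v} [Ring R] [Algebra ℝ R]
    (𝒜 : G → Submodule ℝ R) : Set G :=
  {g | 𝒜 g ≠ ⊥}

/-- A division grading: every nonzero homogeneous element is invertible. -/
def IsDivisionGrading {G : Type u} {R : Type v} [Ring R] [Algebra ℝ R]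
    (𝒜 : G → Submodule ℝ R) : Prop :=
  ∀ g : G, ∀ a ∈ 𝒜 g, a ≠ 0 → IsUnit a

/-- `ℬ` is a refinement of `𝒜`: every component of `ℬ` lies in a component of `𝒜`. -/
def IsRefinement {H : Type*} {G : Type*} {R : Type*} [Ring R] [Algebra ℝ R]
    (ℬ : H → Submodule ℝ R) (𝒜 : G → Submodule ℝ R) : Prop :=
  ∀ h : H, ∃ g : G, ℬ h ≤ 𝒜 g

/-- `ℬ` is a proper refinement of `𝒜`: it is a refinement, and for at least one element of its
support the containment is strict. -/
def IsProperRefinement {H : Type*} {G : Type*} {R : Type*} [Ring R] [Algebra ℝ R]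
    (ℬ : H → Submodule ℝ R) (𝒜 : G → Submodule ℝ R) : Prop :=
  IsRefinement ℬ 𝒜 ∧ ∃ h : H, ℬ h ≠ ⊥ ∧ ∃ g : G, ℬ h < 𝒜 g

/-- A fine grading: no grading of the algebra by an abelian group is a proper refinement. -/
def IsFineGrading {G : Type u} {R : Type v} [Ring R] [Algebra ℝ R]
    (𝒜 : G → Submodule ℝ R) : Prop :=
  ∀ (H : Type u) [AddCommGroup H] [DecidableEq H] (ℬ : H → Submodule ℝ R) [GradedAlgebra ℬ],
    ¬ IsProperRefinement ℬ 𝒜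

/-- Equivalence of gradings: an algebra isomorphism which, together with its inverse, maps every
component into some component. -/
def GradingEquivalent {G : Type*} {H : Type*} {R : Type*} {S : Type*} [Ring R] [Algebra ℝ R]
    [Ring S] [Algebra ℝ S] (𝒜 : G → Submodule ℝ R) (ℬ : H → Submodule ℝ S) : Prop :=
  ∃ φ : R ≃ₐ[ℝ] S,
    (∀ g : G, ∃ h : H, (𝒜 g).map φ.toLinearMap ≤ ℬ h) ∧
    (∀ h : H, ∃ g : G, (ℬ h).map φ.symm.toLinearMap ≤ 𝒜 g)

/-- Isomorphism of gradings by the same group: an algebra isomorphism that preserves degrees. -/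
def GradingIsomorphic {G : Type*} {R : Type*} {S : Type*} [Ring R] [Algebra ℝ R]
    [Ring S] [Algebra ℝ S] (𝒜 : G → Submodule ℝ R) (ℬ : G → Submodule ℝ S) : Prop :=
  ∃ φ : R ≃ₐ[ℝ] S, ∀ g : G, (𝒜 g).map φ.toLinearMap = ℬ g

/-- The components obtained by giving the elements `x i` the degrees `d i`: the component of
degree `g` is spanned by the monomials `x i₁ ⋯ x iₗ` with `d i₁ + ⋯ + d iₗ = g`. -/
def monomialGrading {ι : Type*} {G : Type*} [AddCommGroup G] {R : Type*} [Ring R] [Algebra ℝ R]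
    (x : ι → R) (d : ι → G) (g : G) : Submodule ℝ R :=
  Submodule.span ℝ {a | ∃ l : List ι, (l.map d).sum = g ∧ a = (l.map x).prod}

/-! ### Clifford algebras with the grading `C^gr(p, m)` -/

/-- The standard real quadratic form `x₁² + ⋯ + xₚ² - xₚ₊₁² - ⋯ - xₚ₊ₘ²`. -/
noncomputable def standardForm (p m : ℕ) : QuadraticForm ℝ (Fin (p + m) → ℝ) :=
  QuadraticMap.weightedSumSquares ℝ (fun i : Fin (p + m) => if i.val < p then (1 : ℝ) else -1)

/-- The Clifford algebra `C(p, m)` with the convention `x * x = -q x`: the first `p` basis vectors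
square to `-1`, the last `m` to `1`. -/
abbrev Cliff (p m : ℕ) : Type := CliffordAlgebra (-standardForm p m)

/-- The image in `C(p, m)` of the `i`-th vector of the standard orthogonal basis. -/
noncomputable def cliffGen (p m : ℕ) (i : Fin (p + m)) : Cliff p m :=
  CliffordAlgebra.ι (-standardForm p m) (Pi.single i 1)

/-- The grading `C^gr(p, m)` by an elementary abelian 2-group of rank `p + m`, in which the degrees
of the basis vectors form a basis. -/
noncomputable def cliffGrading (p m : ℕ) :
    (Fin (p + m) → ZMod 2) → Submodule ℝ (Cliff p m) :=
  monomialGrading (cliffGen p m) (fun i => Pi.single i 1)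

/-! ### The gradings `M_2^(4)` and `ℍ^(4)`, and tensor products of gradings -/

/-- The matrix `A = diag(1, -1)`. -/
noncomputable def sylvesterA : Matrix (Fin 2) (Fin 2) ℝ := !![1, 0; 0, -1]

/-- The matrix `B` that exchanges the two basis vectors. -/
noncomputable def sylvesterB : Matrix (Fin 2) (Fin 2) ℝ := !![0, 1; 1, 0]

/-- `M_2^(4)`: the grading of `M_2(ℝ)` by `ℤ/2 × ℤ/2` with components spanned by `I`, `A`, `B`,
`A * B`. -/
noncomputable def m2Grading (g : ZMod 2 × ZMod 2) : Submodule ℝ (Matrix (Fin 2) (Fin 2) ℝ) :=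
  Submodule.span ℝ {sylvesterA ^ g.1.val * sylvesterB ^ g.2.val}

/-- `ℍ^(4)`: the grading of the quaternions by `ℤ/2 × ℤ/2` with components spanned by `1`, `i`,
`j`, `k = i * j`. -/
noncomputable def quaternionGrading (g : ZMod 2 × ZMod 2) : Submodule ℝ ℍ[ℝ] :=
  Submodule.span ℝ {(⟨0, 1, 0, 0⟩ : ℍ[ℝ]) ^ g.1.val * (⟨0, 0, 1, 0⟩ : ℍ[ℝ]) ^ g.2.val}

/-- The algebra `M_2(ℝ)^{⊗ k}`. -/
abbrev M2Power (k : ℕ) : Type := ⨂[ℝ] _ : Fin k, Matrix (Fin 2) (Fin 2) ℝ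

/-- The tensor product grading `(M_2^(4))^{⊗ k}`, by the group `(ℤ/2 × ℤ/2)^k`. -/
noncomputable def m2PowerGrading (k : ℕ) (g : Fin k → ZMod 2 × ZMod 2) :
    Submodule ℝ (M2Power k) :=
  Submodule.span ℝ {t | ∃ a : Fin k → Matrix (Fin 2) (Fin 2) ℝ,
    (∀ i, a i ∈ m2Grading (g i)) ∧ t = PiTensorProduct.tprod ℝ a}

/-- The tensor product of two gradings, by the product of the grading groups. -/
noncomputable def tensorGrading {G : Type*} {H : Type*} {R : Type*} {S : Type*} [Ring R] [Algebra ℝ R]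
    [Ring S] [Algebra ℝ S] (𝒜 : G → Submodule ℝ R) (ℬ : H → Submodule ℝ S) (g : G × H) :
    Submodule ℝ (R ⊗[ℝ] S) :=
  Submodule.span ℝ {t | ∃ a ∈ 𝒜 g.1, ∃ b ∈ ℬ g.2, t = a ⊗ₜ[ℝ] b}

/-! ### Graded presentations by anticommuting generators -/

/-- The relations `x i * x i = ε i` and `x u * x v = - x v * x u` for `u < v`. -/
inductive AnticommRel {n : ℕ} (ε : Fin n → ℝ) :
    FreeAlgebra ℝ (Fin n) → FreeAlgebra ℝ (Fin n) → Prop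
  | sq (i : Fin n) :
      AnticommRel ε (FreeAlgebra.ι ℝ i * FreeAlgebra.ι ℝ i) (algebraMap ℝ _ (ε i))
  | anticomm (s t : Fin n) (h : s < t) :
      AnticommRel ε (FreeAlgebra.ι ℝ s * FreeAlgebra.ι ℝ t)
        (-(FreeAlgebra.ι ℝ t * FreeAlgebra.ι ℝ s))

/-- The algebra with generators `x i` and the relations above: the free associative unital algebra
modulo the two-sided ideal that they generate. -/
abbrev AnticommAlgebra {n : ℕ} (ε : Fin n → ℝ) : Type := RingQuot (AnticommRel ε)

/-- The generator `x i` of the presented algebra. -/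
noncomputable def anticommGen {n : ℕ} (ε : Fin n → ℝ) (i : Fin n) : AnticommAlgebra ε :=
  RingQuot.mkAlgHom ℝ (AnticommRel ε) (FreeAlgebra.ι ℝ i)

/-- The family `α` is a basis of `G`, seen as a vector space over `ℤ/2` (in particular `G` is an
elementary abelian 2-group). -/
def IsElementaryBasis {n : ℕ} {G : Type*} [AddCommGroup G] (α : Fin n → G) : Prop :=
  ∃ (_ : Module (ZMod 2) G) (b : Module.Basis (Fin n) (ZMod 2) G), ∀ i, b i = α i

/-- The graded algebra `𝒜` has the graded presentation with generators `x i`, relations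
`x i ^ 2 = ε i`, `x u * x v = - x v * x u` for `u < v`, and `deg (x i) = α i` for some basis `α` of
the grading group, an elementary abelian 2-group. -/
def HasAnticommPresentation {n : ℕ} (ε : Fin n → ℝ) {G : Type*} [AddCommGroup G] {R : Type*}
    [Ring R] [Algebra ℝ R] (𝒜 : G → Submodule ℝ R) : Prop :=
  ∃ α : Fin n → G, IsElementaryBasis α ∧
    GradingIsomorphic 𝒜 (monomialGrading (anticommGen ε) α)

/-- The signs `-1` for the first `p` of `n` generators, `1` for the others. -/
noncomputable def firstNegative (n p : ℕ) (i : Fin n) : ℝ := if i.val < p then -1 else 1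

/-! For a fine division grading, the identity component is `ℝ`. Otherwise it contains an `i` with
`i² = -1`. Conjugation by a unit whose square is central is an involution preserving the grading,
so by fineness it is `1` or `-1` on each component; in particular `i` anticommutes with some
homogeneous `u`. A norm computation shows that `u²` is central, but then `u` commutes with the
whole identity component, `i` included.

Once the identity component is `ℝ`, homogeneous units commute up to a scalar, which is `±1` by
taking norms, and their squares are central, hence real. Such an algebra is generated by mutually
commuting pairs of anticommuting homogeneous elements with squares `±1`: as long as the pairs found
so far do not generate, their centralizer contains another one. Multiplying each new pair by a
homogeneous chirality element `ω`, which anticommutes with the previous generators and has square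
`±1`, turns all of them into a single anticommuting family. The sum of the squares of its members is
`ω² - 1`, so among `2k` generators `k` or `k + 1` have square `-1`.

A grading with one-dimensional components on an algebra of dimension `2ⁿ`, `n` even, that contains
`n` homogeneous anticommuting elements of given nonzero squares is determined by these squares. This
identifies the Clifford algebras with the tensor products and, ungraded, with the matrix algebras.
-/

/-! ### Signs, joint eigenvectors and spans -/

/-- The sign character `s ↦ (-1)ˢ` of `ℤ/2`, with values in a commutative ring: gradings by
`ℤ/2` are compared with eigenspaces of involutions through it. -/
def signChar (K : Type*) [CommRing K] : AddChar (ZMod 2) K :=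
  AddChar.zmodChar 2 (ζ := -1) (neg_one_sq)

lemma signChar_one (K : Type*) [CommRing K] : signChar K 1 = -1 := by
  simp [signChar, AddChar.zmodChar_apply, ZMod.val_one]

lemma zmod_two_eq_zero_or_one (s : ZMod 2) : s = 0 ∨ s = 1 := by
  revert s; decide

lemma signChar_injective (K : Type*) [CommRing K] [NeZero (2 : K)] :
    Function.Injective (signChar K) := by
  have h : (1 : K) ≠ -1 := fun h => NeZero.ne (2 : K) (by linear_combination h)
  intro s t hst
  rcases zmod_two_eq_zero_or_one s with rfl | rfl <;>
    rcases zmod_two_eq_zero_or_one t with rfl | rfl <;>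
    simp_all [signChar_one, AddChar.map_zero_eq_one, h.symm]

lemma iSupIndep_of_joint_eigenvectors {ι γ K M : Type*} [CommRing K] [IsDomain K] [AddCommGroup M]
    [Module K M] [Module.IsTorsionFree K M] {f : ι → Module.End K M}
    (hf : ∀ i j, Commute (f i) (f j)) {χ : γ → ι → K} (hχ : Function.Injective χ)
    {p : γ → Submodule K M} (hp : ∀ g, ∀ m ∈ p g, ∀ i, f i m = χ g i • m) : iSupIndep p := by
  have h := Module.End.independent_iInf_maxGenEigenspace_of_forall_mapsTo f
    fun i j => Module.End.mapsTo_maxGenEigenspace_of_comm (hf j i)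
  refine (h.comp hχ).mono fun g m hm => (Submodule.mem_iInf _).2 fun i => ?_
  exact Module.End.eigenspace_le_maxGenEigenspace (Module.End.mem_eigenspace_iff.2 (hp g m hm i))

lemma mul_mem_of_mem_span {K R : Type*} [CommSemiring K] [Semiring R] [Algebra K R] {s t : Set R}
    {p : Submodule K R} (h : ∀ a ∈ s, ∀ b ∈ t, a * b ∈ p) {x y : R} (hx : x ∈ Submodule.span K s)
    (hy : y ∈ Submodule.span K t) : x * y ∈ p := by
  have mul_le : Submodule.span K s * Submodule.span K t ≤ p := by
    rw [Submodule.span_mul_span, Submodule.span_le]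
    exact Set.mul_subset_iff.2 h
  exact mul_le (Submodule.mul_mem_mul hx hy)

/-! ### Monomial gradings -/

section Monomial

variable {ι G H R S : Type*} [AddCommGroup G] [AddCommGroup H] [Ring R] [Algebra ℝ R]
  [Ring S] [Algebra ℝ S]

lemma prod_mem_monomialGrading (x : ι → R) (d : ι → G) (l : List ι) :
    (l.map x).prod ∈ monomialGrading x d (l.map d).sum :=
  Submodule.subset_span ⟨l, rfl, rfl⟩

lemma monomialGrading_map (φ : R →ₐ[ℝ] S) (x : ι → R) (d : ι → G) (g : G) :
    (monomialGrading x d g).map φ.toLinearMap = monomialGrading (φ ∘ x) d g := by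
  rw [monomialGrading, Submodule.map_span, monomialGrading]
  congr 1
  ext a
  constructor
  · rintro ⟨_, ⟨l, hl, rfl⟩, rfl⟩
    exact ⟨l, hl, by simp [map_list_prod]⟩
  · rintro ⟨l, hl, rfl⟩
    exact ⟨_, ⟨l, hl, rfl⟩, by simp [map_list_prod]⟩

lemma monomialGrading_degree_equiv (e : G ≃+ H) (x : ι → R) (d : ι → G) (g : G) :
    monomialGrading x (e ∘ d) (e g) = monomialGrading x d g := by
  have map_sum (l : List ι) : (l.map (e ∘ d)).sum = e (l.map d).sum := by
    rw [map_list_sum, List.map_map]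
  simp only [monomialGrading, map_sum, e.injective.eq_iff]

lemma monomialGrading_le {𝒜 : G → Submodule ℝ R} [SetLike.GradedMonoid 𝒜] {x : ι → R} {d : ι → G}
    (hx : ∀ i, x i ∈ 𝒜 (d i)) (g : G) : monomialGrading x d g ≤ 𝒜 g := by
  refine Submodule.span_le.2 ?_
  rintro _ ⟨l, rfl, rfl⟩
  exact SetLike.list_prod_map_mem_graded l d x fun i _ => hx i

instance monomialGrading.gradedMonoid (x : ι → R) (d : ι → G) :
    SetLike.GradedMonoid (monomialGrading x d) where
  one_mem := by simpa using prod_mem_monomialGrading x d []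
  mul_mem g h a b ha hb := by
    refine mul_mem_of_mem_span ?_ ha hb
    rintro _ ⟨l, rfl, rfl⟩ _ ⟨l', rfl, rfl⟩
    exact Submodule.subset_span ⟨l ++ l', by simp, by simp⟩

lemma iSup_monomialGrading (x : ι → R) (d : ι → G) :
    ⨆ g, monomialGrading x d g = Subalgebra.toSubmodule (Algebra.adjoin ℝ (Set.range x)) := by
  refine le_antisymm (iSup_le fun g => Submodule.span_le.2 ?_) ?_
  · rintro _ ⟨l, -, rfl⟩
    refine list_prod_mem (S := Algebra.adjoin ℝ (Set.range x)) fun a ha => ?_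
    obtain ⟨i, -, rfl⟩ := List.mem_map.1 ha
    exact Algebra.subset_adjoin ⟨i, rfl⟩
  · rw [Algebra.adjoin_eq_span, Submodule.span_le]
    intro a ha
    obtain ⟨l, hl, rfl⟩ := Submonoid.exists_list_of_mem_closure ha
    obtain ⟨w, rfl⟩ : l ∈ Set.range (List.map x) := by rw [Set.range_list_map]; exact hl
    exact le_iSup (monomialGrading x d) _ (prod_mem_monomialGrading x d w)

end Monomial

/-! ### Words in anticommuting elements -/

/-- Pairwise anticommuting elements with prescribed nonzero scalar squares: the images of the
generators of a presentation `x i ^ 2 = ε i`, `x i * x j = - x j * x i`. -/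
structure IsAnticommSystem {ι K R : Type*} [Field K] [Ring R] [Algebra K R] (ε : ι → K)
    (x : ι → R) : Prop where
  sq : ∀ i, x i * x i = algebraMap K R (ε i)
  anticomm : ∀ i j, i ≠ j → x i * x j = -(x j * x i)
  ne_zero : ∀ i, ε i ≠ 0

section WordDegree

variable {ι : Type*} [DecidableEq ι]

/-- The degree of a word in the elementary abelian 2-group freely generated by the letters: the
numbers of occurrences of the letters modulo 2. -/
def wordDegree (l : List ι) : ι → ZMod 2 :=
  (l.map fun i => Pi.single i (1 : ZMod 2)).sum

lemma wordDegree_cons (a : ι) (l : List ι) :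
    wordDegree (a :: l) = Pi.single a 1 + wordDegree l := by
  simp [wordDegree]

lemma wordDegree_append (l l' : List ι) :
    wordDegree (l ++ l') = wordDegree l + wordDegree l' := by
  simp [wordDegree]

lemma wordDegree_append_self (l : List ι) : wordDegree (l ++ l) = 0 := by
  rw [wordDegree_append]
  exact funext fun _ => CharTwo.add_self_eq_zero _

lemma wordDegree_perm {l l' : List ι} (h : l.Perm l') : wordDegree l = wordDegree l' :=
  (h.map _).sum_eq

lemma wordDegree_apply (l : List ι) (i : ι) : wordDegree l i = (l.count i : ZMod 2) := by
  induction l with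
  | nil => rfl
  | cons a l ih =>
    rw [wordDegree_cons, Pi.add_apply, ih]
    rcases eq_or_ne i a with rfl | h
    · simp [add_comm]
    · simp [Pi.single_eq_of_ne h, List.count_cons_of_ne h.symm]

lemma wordDegree_surjective [Finite ι] : Function.Surjective (wordDegree (ι := ι)) := by
  have := Fintype.ofFinite ι
  intro g
  refine ⟨Finset.univ.toList.filter (g · = 1), funext fun i => ?_⟩
  rw [wordDegree_apply]
  rcases zmod_two_eq_zero_or_one (g i) with hi | hi
  · rw [hi, List.count_eq_zero_of_not_mem (by simp [hi]), Nat.cast_zero]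
  · rw [List.count_filter (by simpa using hi), hi,
      List.count_eq_one_of_mem (Finset.nodup_toList _) (by simp), Nat.cast_one]

lemma exists_perm_of_wordDegree_cons_eq_zero {a : ι} {l : List ι} (h : wordDegree (a :: l) = 0) :
    ∃ l', (a :: l).Perm (a :: a :: l') ∧ wordDegree l' = 0 := by
  have ha : a ∈ l := by
    by_contra ha
    have := congrFun h a
    rw [wordDegree_apply, List.count_cons_self, List.count_eq_zero_of_not_mem ha] at this
    simp at this
  have hl := (List.perm_cons_erase ha).cons a
  refine ⟨l.erase a, hl, ?_⟩
  rwa [wordDegree_perm hl, show a :: a :: l.erase a = [a] ++ [a] ++ l.erase a from rfl,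
    wordDegree_append, wordDegree_append_self, zero_add] at h

end WordDegree

section CommDegree

variable {ι : Type*} [Fintype ι]

/-- The commutation pairing of words and letters: in an anticommuting system the `j`-th element
commutes with the words of degree `g` up to the sign `(-1) ^ commDegree g j`. -/
def commDegree : (ι → ZMod 2) →ₗ[ZMod 2] ι → ZMod 2 :=
  LinearMap.pi fun j => ∑ i, LinearMap.proj i + LinearMap.proj j

lemma commDegree_apply (g : ι → ZMod 2) (j : ι) : commDegree g j = ∑ i, g i + g j := by
  simp [commDegree]

lemma commDegree_injective (hι : Even (Fintype.card ι)) :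
    Function.Injective (commDegree (ι := ι)) := by
  refine (injective_iff_map_eq_zero _).2 fun g hg => ?_
  have eq_sum (j : ι) : g j = ∑ i, g i := by
    have := congrFun hg j
    rw [commDegree_apply, Pi.zero_apply, CharTwo.add_eq_zero] at this
    exact this.symm
  have sum_eq : ∑ i, g i = 0 := by
    rw [Finset.sum_congr rfl fun i _ => eq_sum i, Finset.sum_const, Finset.card_univ,
      nsmul_eq_mul, (ZMod.natCast_eq_zero_iff_even).2 hι, zero_mul]
  exact funext fun j => (eq_sum j).trans sum_eq

lemma commDegree_surjective (hι : Even (Fintype.card ι)) :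
    Function.Surjective (commDegree (ι := ι)) :=
  Finite.surjective_of_injective (commDegree_injective hι)

end CommDegree

namespace IsAnticommSystem

variable {ι κ K R S : Type*} [Field K] [Ring R] [Algebra K R] [Ring S] [Algebra K S] {ε : ι → K}
  {x : ι → R}

lemma comp_injective (h : IsAnticommSystem ε x) {e : κ → ι} (he : Function.Injective e) :
    IsAnticommSystem (ε ∘ e) (x ∘ e) :=
  ⟨fun _ => h.sq _, fun _ _ hij => h.anticomm _ _ (he.ne hij), fun _ => h.ne_zero _⟩

lemma map (h : IsAnticommSystem ε x) (φ : R →ₐ[K] S) : IsAnticommSystem ε (φ ∘ x) :=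
  ⟨fun i => by simp [← map_mul, h.sq], fun i j hij => by
    simp only [Function.comp_apply, ← map_mul, ← map_neg, h.anticomm i j hij], h.ne_zero⟩

lemma isUnit (h : IsAnticommSystem ε x) (i : ι) : IsUnit (x i) := by
  have isUnit_sq : IsUnit (x i * x i) := by
    rw [h.sq]; exact (IsUnit.mk0 _ (h.ne_zero i)).map (algebraMap K R)
  exact ((Commute.refl (x i)).isUnit_mul_iff.1 isUnit_sq).1

lemma isUnit_prod (h : IsAnticommSystem ε x) (l : List ι) : IsUnit (l.map x).prod := by
  induction l with
  | nil => simp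
  | cons a l ih => simpa using (h.isUnit a).mul ih

lemma prod_perm (h : IsAnticommSystem ε x) {l l' : List ι} (hl : l.Perm l') :
    ∃ c : K, c ≠ 0 ∧ (l.map x).prod = c • (l'.map x).prod := by
  induction hl with
  | nil => exact ⟨1, one_ne_zero, by simp⟩
  | cons a _ ih =>
    obtain ⟨c, hc, hc'⟩ := ih
    exact ⟨c, hc, by simp [hc']⟩
  | swap a b l =>
    by_cases hab : b = a
    · exact ⟨1, one_ne_zero, by simp [hab]⟩
    · refine ⟨-1, by norm_num, ?_⟩
      simp only [List.map_cons, List.prod_cons, ← mul_assoc]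
      rw [h.anticomm b a hab]; simp
  | trans _ _ ih1 ih2 =>
    obtain ⟨c, hc, hc'⟩ := ih1
    obtain ⟨d, hd, hd'⟩ := ih2
    exact ⟨c * d, mul_ne_zero hc hd, by rw [hc', hd', smul_smul]⟩

variable [DecidableEq ι]

lemma prod_of_wordDegree_eq_zero (h : IsAnticommSystem ε x) (l : List ι)
    (hl : wordDegree l = 0) : ∃ c : K, c ≠ 0 ∧ (l.map x).prod = algebraMap K R c := by
  induction hn : l.length using Nat.strong_induction_on generalizing l with
  | _ n ih =>
    match l, hl, hn with
    | [], _, _ => exact ⟨1, one_ne_zero, by simp⟩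
    | a :: t, hl, hn =>
      obtain ⟨l', hperm, hl'⟩ := exists_perm_of_wordDegree_cons_eq_zero hl
      have hlen : l'.length < n := by
        have := hperm.length_eq
        simp only [List.length_cons] at this hn
        omega
      obtain ⟨c, hc, hc'⟩ := h.prod_perm hperm
      obtain ⟨d, hd, hd'⟩ := ih _ hlen l' hl' rfl
      refine ⟨c * (ε a * d), mul_ne_zero hc (mul_ne_zero (h.ne_zero a) hd), ?_⟩
      rw [hc', List.map_cons, List.prod_cons, List.map_cons, List.prod_cons, hd', ← mul_assoc,
        h.sq, Algebra.smul_def, ← map_mul, ← map_mul]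

/-- Both `l ++ l'` and `l' ++ l'` have degree zero, so their products with `l'` are scalars. -/
lemma prod_of_wordDegree_eq (h : IsAnticommSystem ε x) {l l' : List ι}
    (hl : wordDegree l = wordDegree l') :
    ∃ c : K, (l.map x).prod = c • (l'.map x).prod := by
  obtain ⟨c, -, hc⟩ := h.prod_of_wordDegree_eq_zero (l ++ l') (by
    rw [wordDegree_append, hl, ← wordDegree_append, wordDegree_append_self])
  obtain ⟨d, hd, hd'⟩ := h.prod_of_wordDegree_eq_zero (l' ++ l') (wordDegree_append_self l')
  rw [List.map_append, List.prod_append] at hc hd'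
  refine ⟨c / d, (h.isUnit_prod l').mul_left_injective ?_⟩
  simp only [smul_mul_assoc]
  rw [hc, hd', Algebra.smul_def, ← map_mul, div_mul_cancel₀ c hd]

lemma mul_prod [Fintype ι] (h : IsAnticommSystem ε x) (j : ι) (l : List ι) :
    x j * (l.map x).prod =
      signChar K (commDegree (wordDegree l) j) • ((l.map x).prod * x j) := by
  induction l with
  | nil => simp [wordDegree]
  | cons a l ih =>
    have mul_letter : x j * x a = signChar K (commDegree (Pi.single a 1) j) • (x a * x j) := by
      by_cases hj : j = a
      · simp [hj, commDegree_apply, CharTwo.add_self_eq_zero]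
      · simp [commDegree_apply, signChar_one, h.anticomm j a hj, Pi.single_eq_of_ne hj]
    rw [wordDegree_cons, map_add, Pi.add_apply, AddChar.map_add_eq_mul, List.map_cons,
      List.prod_cons, ← mul_assoc, mul_letter, smul_mul_assoc, mul_assoc, ih, mul_smul_comm,
      smul_smul, mul_assoc]

end IsAnticommSystem

/-! ### Standard gradings -/

lemma isFineGrading_of_finrank_eq_one {G : Type u} {R : Type v} [Ring R] [Algebra ℝ R]
    {𝒜 : G → Submodule ℝ R} (h : ∀ g, Module.finrank ℝ (𝒜 g) = 1) : IsFineGrading 𝒜 := by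
  rintro H _ _ ℬ _ ⟨-, k, hk, g, hg⟩
  have := Module.finite_of_finrank_pos (R := ℝ) (M := 𝒜 g) (by rw [h]; norm_num)
  have finrank_lt := Submodule.finrank_lt_finrank_of_lt hg
  rw [h, Nat.lt_one_iff] at finrank_lt
  have := Submodule.finiteDimensional_of_le hg.le
  exact hk (Submodule.finrank_eq_zero.1 finrank_lt)

/-- The monomial grading in which the degrees of the generators are the standard basis vectors,
as in `C^gr(p, m)`. -/
abbrev standardGrading {ι R : Type*} [DecidableEq ι] [Ring R] [Algebra ℝ R]
    (x : ι → R) : (ι → ZMod 2) → Submodule ℝ R :=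
  monomialGrading x (fun i => Pi.single i 1)

namespace IsAnticommSystem

variable {ι R : Type*} [Ring R] [Algebra ℝ R] {ε : ι → ℝ} {x : ι → R}

section StandardGrading

variable [DecidableEq ι]

lemma standardGrading_wordDegree (h : IsAnticommSystem ε x) (l : List ι) :
    standardGrading x (wordDegree l) = Submodule.span ℝ {(l.map x).prod} := by
  refine le_antisymm (Submodule.span_le.2 ?_)
    ((Submodule.span_singleton_le_iff_mem _ _).2 (prod_mem_monomialGrading x _ l))
  rintro _ ⟨l', hl', rfl⟩
  obtain ⟨c, hc⟩ := h.prod_of_wordDegree_eq (l := l') (l' := l) hl'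
  exact Submodule.mem_span_singleton.2 ⟨c, hc.symm⟩

lemma isDivisionGrading [Finite ι] (h : IsAnticommSystem ε x) :
    IsDivisionGrading (standardGrading x) := by
  intro g a ha ha0
  obtain ⟨l, rfl⟩ := wordDegree_surjective g
  rw [h.standardGrading_wordDegree, Submodule.mem_span_singleton] at ha
  obtain ⟨c, rfl⟩ := ha
  rw [Algebra.smul_def]
  exact ((IsUnit.mk0 c (left_ne_zero_of_smul ha0)).map (algebraMap ℝ R)).mul (h.isUnit_prod l)

lemma finrank_standardGrading [Finite ι] [Nontrivial R] (h : IsAnticommSystem ε x)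
    (g : ι → ZMod 2) : Module.finrank ℝ (standardGrading x g) = 1 := by
  obtain ⟨l, rfl⟩ := wordDegree_surjective g
  rw [h.standardGrading_wordDegree]
  exact finrank_span_singleton (h.isUnit_prod l).ne_zero

variable [Fintype ι]

lemma mul_of_mem_standardGrading (h : IsAnticommSystem ε x) {g : ι → ZMod 2} {a : R}
    (ha : a ∈ standardGrading x g) (j : ι) :
    x j * a = signChar ℝ (commDegree g j) • (a * x j) := by
  obtain ⟨l, rfl⟩ := wordDegree_surjective g
  rw [h.standardGrading_wordDegree, Submodule.mem_span_singleton] at ha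
  obtain ⟨c, rfl⟩ := ha
  rw [mul_smul_comm, h.mul_prod, smul_mul_assoc, smul_comm]

/-- The components are joint eigenspaces of the conjugations by the generators, and the
eigenvalues determine the degree because the number of generators is even. -/
lemma iSupIndep_standardGrading (h : IsAnticommSystem ε x) (hι : Even (Fintype.card ι)) :
    iSupIndep (standardGrading x) := by
  let conj (j : ι) : Module.End ℝ R := LinearMap.mulLeftRight ℝ (x j, (ε j)⁻¹ • x j)
  have conj_apply (j : ι) (a : R) : conj j a = (ε j)⁻¹ • (x j * a * x j) := by
    simp [conj, LinearMap.mulLeftRight_apply]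
  refine iSupIndep_of_joint_eigenvectors (f := conj)
    (χ := fun g j => signChar ℝ (commDegree g j)) ?_
    ((signChar_injective ℝ).comp_left.comp (commDegree_injective hι)) fun g a ha j => ?_
  · intro i j
    rcases eq_or_ne i j with rfl | hij
    · rfl
    · refine LinearMap.ext fun a => ?_
      simp only [Module.End.mul_apply, conj_apply, mul_smul_comm, smul_mul_assoc]
      rw [smul_comm]
      congr 2
      calc x i * (x j * a * x j) * x i = (x i * x j) * a * (x j * x i) := by noncomm_ring
        _ = (x j * x i) * a * (x i * x j) := by
          rw [h.anticomm i j hij]; noncomm_ring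
        _ = x j * (x i * a * x i) * x j := by noncomm_ring
  · rw [conj_apply, h.mul_of_mem_standardGrading ha, smul_mul_assoc, mul_assoc, h.sq,
      ← Algebra.commutes, ← Algebra.smul_def, smul_comm, inv_smul_smul₀ (h.ne_zero j)]

lemma nonempty_gradedAlgebra (h : IsAnticommSystem ε x) (hι : Even (Fintype.card ι))
    (hx : Algebra.adjoin ℝ (Set.range x) = ⊤) :
    Nonempty (GradedAlgebra (standardGrading x)) := by
  have internal := DirectSum.isInternal_submodule_of_iSupIndep_of_iSup_eq_top
    (h.iSupIndep_standardGrading hι) (by rw [iSup_monomialGrading, hx, Algebra.top_toSubmodule])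
  exact ⟨{ monomialGrading.gradedMonoid x _, internal.chooseDecomposition _ with }⟩

end StandardGrading

variable [Fintype ι] [Nontrivial R]

lemma finrank_adjoin (h : IsAnticommSystem ε x) (hι : Even (Fintype.card ι)) :
    Module.finrank ℝ (Algebra.adjoin ℝ (Set.range x)) = 2 ^ Fintype.card ι := by
  classical
  let w := Function.surjInv (wordDegree_surjective (ι := ι))
  have hw (g : ι → ZMod 2) :
      standardGrading x g = Submodule.span ℝ {((w g).map x).prod} := by
    rw [← h.standardGrading_wordDegree, Function.surjInv_eq wordDegree_surjective]
  have linearIndependent : LinearIndependent ℝ fun g => ((w g).map x).prod :=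
    (h.iSupIndep_standardGrading hι).linearIndependent _
      (fun g => hw g ▸ Submodule.mem_span_singleton_self _) fun g => (h.isUnit_prod _).ne_zero
  have span_eq : Subalgebra.toSubmodule (Algebra.adjoin ℝ (Set.range x)) =
      Submodule.span ℝ (Set.range fun g => ((w g).map x).prod) := by
    rw [← iSup_monomialGrading x fun i => Pi.single i (1 : ZMod 2), Submodule.span_range_eq_iSup]
    exact iSup_congr hw
  rw [← Subalgebra.finrank_toSubmodule, span_eq, finrank_span_eq_card linearIndependent]
  simp

lemma pow_card_le_finrank [FiniteDimensional ℝ R] (h : IsAnticommSystem ε x)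
    (hι : Even (Fintype.card ι)) : 2 ^ Fintype.card ι ≤ Module.finrank ℝ R := by
  rw [← h.finrank_adjoin hι, ← Subalgebra.finrank_toSubmodule]
  exact Submodule.finrank_le _

lemma finrank_eq (h : IsAnticommSystem ε x) (hι : Even (Fintype.card ι))
    (hx : Algebra.adjoin ℝ (Set.range x) = ⊤) :
    Module.finrank ℝ R = 2 ^ Fintype.card ι := by
  rw [← h.finrank_adjoin hι, hx, ← Subalgebra.finrank_toSubmodule, Algebra.top_toSubmodule,
    finrank_top]

lemma adjoin_eq_top (h : IsAnticommSystem ε x) (hι : Even (Fintype.card ι))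
    (hR : Module.finrank ℝ R = 2 ^ Fintype.card ι) : Algebra.adjoin ℝ (Set.range x) = ⊤ := by
  have : FiniteDimensional ℝ R := Module.finite_of_finrank_pos (by rw [hR]; positivity)
  refine Subalgebra.eq_of_le_of_finrank_eq le_top ?_
  rw [h.finrank_adjoin hι, ← hR, ← Subalgebra.finrank_toSubmodule, Algebra.top_toSubmodule,
    finrank_top]

end IsAnticommSystem

/-! ### Graded presentations -/

section Presentation

variable {n : ℕ} {ε : Fin n → ℝ}

lemma isAnticommSystem_anticommGen (hε : ∀ i, ε i ≠ 0) :
    IsAnticommSystem ε (anticommGen ε) where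
  sq i := by
    simp only [anticommGen, ← map_mul]
    rw [RingQuot.mkAlgHom_rel ℝ (AnticommRel.sq i), AlgHom.commutes]
  anticomm i j hij := by
    have anticomm_of_lt (s t : Fin n) (hst : s < t) :
        anticommGen ε s * anticommGen ε t = -(anticommGen ε t * anticommGen ε s) := by
      simp only [anticommGen, ← map_mul, ← map_neg]
      exact RingQuot.mkAlgHom_rel ℝ (AnticommRel.anticomm s t hst)
    rcases lt_or_gt_of_ne hij with h | h
    · exact anticomm_of_lt i j h
    · rw [anticomm_of_lt j i h, neg_neg]
  ne_zero := hε

lemma adjoin_anticommGen : Algebra.adjoin ℝ (Set.range (anticommGen ε)) = ⊤ := by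
  have : Set.range (anticommGen ε) =
      RingQuot.mkAlgHom ℝ (AnticommRel ε) '' Set.range (FreeAlgebra.ι ℝ) := by
    rw [← Set.range_comp]; rfl
  rw [this, ← AlgHom.map_adjoin, FreeAlgebra.adjoin_range_ι, Algebra.map_top,
    AlgHom.range_eq_top]
  exact RingQuot.mkAlgHom_surjective ℝ _

namespace IsAnticommSystem

variable {R : Type*} [Ring R] [Algebra ℝ R] {x : Fin n → R}

/-- The algebra map from the presented algebra that sends its generators to the elements of an
anticommuting system with the same squares. -/
noncomputable def lift (h : IsAnticommSystem ε x) : AnticommAlgebra ε →ₐ[ℝ] R :=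
  RingQuot.liftAlgHom ℝ ⟨FreeAlgebra.lift ℝ x, by
    rintro _ _ (i | ⟨s, t, hst⟩)
    · simp [h.sq]
    · simp [h.anticomm s t hst.ne]⟩

lemma lift_anticommGen (h : IsAnticommSystem ε x) (i : Fin n) : h.lift (anticommGen ε i) = x i := by
  simp [lift, anticommGen]

lemma exists_algEquiv_anticommAlgebra [Nontrivial R] (h : IsAnticommSystem ε x) (hn : Even n)
    (hx : Algebra.adjoin ℝ (Set.range x) = ⊤) :
    ∃ φ : R ≃ₐ[ℝ] AnticommAlgebra ε, φ ∘ x = anticommGen ε := by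
  have : Nontrivial (AnticommAlgebra ε) := h.lift.toRingHom.domain_nontrivial
  have card_even : Even (Fintype.card (Fin n)) := by simpa using hn
  have finrank_presented :=
    (isAnticommSystem_anticommGen h.ne_zero).finrank_eq card_even adjoin_anticommGen
  have finrank_R := h.finrank_eq card_even hx
  have := Module.finite_of_finrank_pos (R := ℝ) (M := AnticommAlgebra ε) (by
    rw [finrank_presented]; positivity)
  have := Module.finite_of_finrank_pos (R := ℝ) (M := R) (by rw [finrank_R]; positivity)
  have surjective : Function.Surjective h.lift := by
    rw [← AlgHom.range_eq_top, eq_top_iff, ← hx, Algebra.adjoin_le_iff]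
    rintro _ ⟨i, rfl⟩
    exact ⟨_, h.lift_anticommGen i⟩
  have injective : Function.Injective h.lift :=
    (LinearMap.injective_iff_surjective_of_finrank_eq_finrank (f := h.lift.toLinearMap)
      (finrank_presented.trans finrank_R.symm)).2 surjective
  refine ⟨(AlgEquiv.ofBijective h.lift ⟨injective, surjective⟩).symm, funext fun i => ?_⟩
  rw [Function.comp_apply, AlgEquiv.symm_apply_eq]
  exact (h.lift_anticommGen i).symm

lemma hasAnticommPresentation_monomialGrading [Nontrivial R] (h : IsAnticommSystem ε x)
    (hn : Even n) (hx : Algebra.adjoin ℝ (Set.range x) = ⊤) {G : Type*} [AddCommGroup G]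
    {α : Fin n → G} (hα : IsElementaryBasis α) :
    HasAnticommPresentation ε (monomialGrading x α) := by
  obtain ⟨φ, hφ⟩ := h.exists_algEquiv_anticommAlgebra hn hx
  exact ⟨α, hα, φ, fun g => by rw [← hφ]; exact monomialGrading_map φ.toAlgHom x α g⟩

end IsAnticommSystem

namespace HasAnticommPresentation

variable {G H R S : Type*} [AddCommGroup G] [AddCommGroup H] [Ring R] [Algebra ℝ R] [Ring S]
  [Algebra ℝ S] {𝒜 : G → Submodule ℝ R} {ℬ : H → Submodule ℝ S}

lemma gradingEquivalent (h𝒜 : HasAnticommPresentation ε 𝒜) (hℬ : HasAnticommPresentation ε ℬ) :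
    GradingEquivalent 𝒜 ℬ := by
  obtain ⟨α, ⟨_, a, ha⟩, φ, hφ⟩ := h𝒜
  obtain ⟨β, ⟨_, b, hb⟩, ψ, hψ⟩ := hℬ
  let e : G ≃+ H := (a.equiv b (Equiv.refl _)).toAddEquiv
  have degree : e ∘ α = β := funext fun i => by
    rw [Function.comp_apply, ← ha, ← hb]; exact a.equiv_apply i b (Equiv.refl _)
  have map_eq (g : G) : (𝒜 g).map φ.toLinearMap = (ℬ (e g)).map ψ.toLinearMap := by
    rw [hφ, hψ, ← degree, monomialGrading_degree_equiv]
  refine ⟨φ.trans ψ.symm, fun g => ⟨e g, ?_⟩, fun h => ⟨e.symm h, ?_⟩⟩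
  · rintro _ ⟨r, hr, rfl⟩
    obtain ⟨s, hs, hsr⟩ := (map_eq g).le ⟨r, hr, rfl⟩
    have : ψ s = φ r := hsr
    simpa [← this] using hs
  · rintro _ ⟨s, hs, rfl⟩
    obtain ⟨r, hr, hrs⟩ := (map_eq (e.symm h)).ge ⟨s, by simpa using hs, rfl⟩
    have : φ r = ψ s := hrs
    simpa [← this] using hr

end HasAnticommPresentation

end Presentation

lemma eq_span_singleton_of_isPrincipal {K M : Type*} [DivisionRing K] [AddCommGroup M] [Module K M]
    {p : Submodule K M} (hp : p.IsPrincipal) {m : M} (hm : m ∈ p) (hm0 : m ≠ 0) :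
    p = Submodule.span K {m} := by
  obtain ⟨a, rfl⟩ := hp
  obtain ⟨c, rfl⟩ := Submodule.mem_span_singleton.1 hm
  exact (Submodule.span_singleton_smul_eq (IsUnit.mk0 c (left_ne_zero_of_smul hm0)) a).symm

lemma zero_le_one_of_isPrincipal {G K R : Type*} [AddMonoid G] [Field K] [Ring R] [Algebra K R]
    [Nontrivial R] {𝒜 : G → Submodule K R} [SetLike.GradedMonoid 𝒜] (h : (𝒜 0).IsPrincipal) :
    𝒜 0 ≤ 1 := by
  rw [eq_span_singleton_of_isPrincipal h (SetLike.GradedOne.one_mem (A := 𝒜)) one_ne_zero,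
    Submodule.one_eq_span]

section Degrees

variable {ι G R : Type*} [AddCommGroup G] [Module (ZMod 2) G] [Ring R] [Algebra ℝ R]

lemma linearCombination_wordDegree [Fintype ι] [DecidableEq ι] (α : ι → G) (l : List ι) :
    Fintype.linearCombination (ZMod 2) α (wordDegree l) = (l.map α).sum := by
  rw [wordDegree, map_list_sum, List.map_map]
  congr 2
  exact funext fun i => by simp

namespace IsAnticommSystem

variable {ε : ι → ℝ} {x : ι → R} {𝒜 : G → Submodule ℝ R} [SetLike.GradedMonoid 𝒜] {α : ι → G}
  [Nontrivial R]

/-- A monomial of degree zero is a scalar, so it commutes with all the generators, and then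
`commDegree` shows that every letter occurs in it an even number of times. -/
lemma linearIndependent_degree [Fintype ι] (h : IsAnticommSystem ε x)
    (hι : Even (Fintype.card ι)) (h0 : 𝒜 0 ≤ 1) (hα : ∀ i, x i ∈ 𝒜 (α i)) :
    LinearIndependent (ZMod 2) α := by
  classical
  rw [linearIndependent_iff_injective_fintypeLinearCombination, injective_iff_map_eq_zero]
  intro g hg
  obtain ⟨l, rfl⟩ := wordDegree_surjective g
  have prod_mem := SetLike.list_prod_map_mem_graded l α x fun i _ => hα i
  rw [← linearCombination_wordDegree, hg] at prod_mem
  obtain ⟨c, hc⟩ := Submodule.mem_one.1 (h0 prod_mem)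
  refine commDegree_injective hι (funext fun j => signChar_injective ℝ ?_)
  have mul_prod := h.mul_prod j l
  have prod_mul : x j * (l.map x).prod = (1 : ℝ) • ((l.map x).prod * x j) := by
    rw [← hc, one_smul, Algebra.commutes]
  rw [prod_mul] at mul_prod
  rw [← smul_left_injective ℝ ((h.isUnit_prod l).mul (h.isUnit j)).ne_zero mul_prod]
  simp

lemma monomialGrading_eq [Finite ι] (h : IsAnticommSystem ε x)
    (h𝒜 : ∀ g, (𝒜 g).IsPrincipal) (hα : ∀ i, x i ∈ 𝒜 (α i))
    (hspan : ⊤ ≤ Submodule.span (ZMod 2) (Set.range α)) :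
    monomialGrading x α = 𝒜 := by
  classical
  have := Fintype.ofFinite ι
  refine funext fun g => le_antisymm (monomialGrading_le hα g) ?_
  obtain ⟨f, rfl⟩ : g ∈ LinearMap.range (Fintype.linearCombination (ZMod 2) α) := by
    rw [Fintype.range_linearCombination]; exact hspan trivial
  obtain ⟨l, rfl⟩ := wordDegree_surjective f
  have prod_mem := prod_mem_monomialGrading x α l
  rw [linearCombination_wordDegree, eq_span_singleton_of_isPrincipal (h𝒜 _)
    (monomialGrading_le hα _ prod_mem) (h.isUnit_prod l).ne_zero]
  exact (Submodule.span_singleton_le_iff_mem _ _).2 prod_mem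

end IsAnticommSystem

lemma IsAnticommSystem.hasAnticommPresentation_of_finrank {n : ℕ} {ε : Fin n → ℝ} {x : Fin n → R}
    [Nontrivial R] (h : IsAnticommSystem ε x) (hn : Even n) (hR : Module.finrank ℝ R = 2 ^ n)
    [Module.Finite (ZMod 2) G] (hG : Module.finrank (ZMod 2) G = n) {𝒜 : G → Submodule ℝ R}
    [SetLike.GradedMonoid 𝒜] (h𝒜 : ∀ g, (𝒜 g).IsPrincipal) {α : Fin n → G}
    (hα : ∀ i, x i ∈ 𝒜 (α i)) : HasAnticommPresentation ε 𝒜 := by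
  have linearIndependent := h.linearIndependent_degree (by simpa using hn)
    (zero_le_one_of_isPrincipal (h𝒜 0)) hα
  have span_eq := (linearIndependent.span_eq_top_of_card_eq_finrank' (by simp [hG])).ge
  rw [← h.monomialGrading_eq h𝒜 hα span_eq]
  exact h.hasAnticommPresentation_monomialGrading hn
    (h.adjoin_eq_top (by simpa using hn) (by simpa using hR))
    ⟨inferInstance, .mk linearIndependent span_eq, fun i => by simp⟩

end Degrees

/-! ### Families of signs -/

section Signs

variable {ι κ K : Type*} [Fintype ι] [Fintype κ] [Field K] [CharZero K]

lemma two_mul_card_fiber_of_sign [DecidableEq K] {ε : ι → K} (hε : ∀ i, ε i = -1 ∨ ε i = 1)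
    {c : K} (hc : c = -1 ∨ c = 1) :
    2 * (Fintype.card {i // ε i = c} : K) = Fintype.card ι + c * ∑ i, ε i := by
  have fiber_indicator (i : ι) : 2 * (if ε i = c then (1 : K) else 0) = 1 + c * ε i := by
    rcases hε i with h | h <;> rcases hc with rfl | rfl <;> norm_num [h]
  rw [Fintype.card_subtype, Finset.natCast_card_filter, Finset.mul_sum, Finset.mul_sum,
    Finset.sum_congr rfl fun i _ => fiber_indicator i, Finset.sum_add_distrib]
  simp

lemma exists_equiv_of_sum_signs_eq {ε : ι → K} {δ : κ → K} (hε : ∀ i, ε i = -1 ∨ ε i = 1)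
    (hδ : ∀ j, δ j = -1 ∨ δ j = 1) (hcard : Fintype.card κ = Fintype.card ι)
    (hsum : ∑ j, δ j = ∑ i, ε i) : ∃ e : κ ≃ ι, ∀ j, ε (e j) = δ j := by
  classical
  suffices h : ∀ c, Nonempty ({j // δ j = c} ≃ {i // ε i = c}) from
    ⟨Equiv.ofFiberEquiv fun c => (h c).some, Equiv.ofFiberEquiv_map _⟩
  intro c
  by_cases hc : c = -1 ∨ c = 1
  · refine ⟨Fintype.equivOfCardEq ?_⟩
    have hfiber := two_mul_card_fiber_of_sign hδ hc
    rw [hcard, hsum, ← two_mul_card_fiber_of_sign hε hc] at hfiber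
    exact_mod_cast mul_left_cancel₀ two_ne_zero hfiber
  · have := Subtype.isEmpty_of_false fun j (hj : δ j = c) => hc (hj ▸ hδ j)
    have := Subtype.isEmpty_of_false fun i (hi : ε i = c) => hc (hi ▸ hε i)
    exact ⟨Equiv.equivOfIsEmpty _ _⟩

end Signs

lemma firstNegative_eq_neg_one_or_one (n p : ℕ) (i : Fin n) :
    firstNegative n p i = -1 ∨ firstNegative n p i = 1 := by
  unfold firstNegative
  split_ifs <;> simp

lemma sum_firstNegative {n p : ℕ} (hp : p ≤ n) :
    ∑ i, firstNegative n p i = (n : ℝ) - 2 * p := by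
  have sub_indicator (i : Fin n) :
      firstNegative n p i = 1 - 2 * (if i.val < p then (1 : ℝ) else 0) := by
    unfold firstNegative
    split_ifs <;> norm_num
  simp only [sub_indicator, Finset.sum_sub_distrib, ← Finset.mul_sum, Finset.sum_boole,
    Fin.card_filter_val_lt, min_eq_right hp]
  simp

/-! ### Fine gradings and division gradings -/

lemma inv_mem_graded_neg {G A σ : Type*} [DecidableEq G] [AddGroup G] [Ring A] [SetLike σ A]
    [AddSubmonoidClass σ A] {𝒜 : G → σ} [GradedRing 𝒜] {g : G} {u : Aˣ} (hu : (u : A) ∈ 𝒜 g) :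
    (↑u⁻¹ : A) ∈ 𝒜 (-g) := by
  have component_eq := DirectSum.coe_decompose_mul_add_of_left_mem 𝒜 (j := -g) (b := ↑u⁻¹) hu
  rw [add_neg_cancel, u.mul_inv, DirectSum.decompose_of_mem_same 𝒜 SetLike.GradedOne.one_mem]
    at component_eq
  rw [u.inv_eq_of_mul_eq_one_right component_eq.symm]
  exact SetLike.coe_mem _

section Fine

variable {G : Type u} [AddCommGroup G] [DecidableEq G] {R : Type v} [Ring R] [Algebra ℝ R]
  {𝒜 : G → Submodule ℝ R} [GradedAlgebra 𝒜]

lemma proj_of_mem {g : G} {a : R} (ha : a ∈ 𝒜 g) (h : G) :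
    GradedAlgebra.proj 𝒜 h a = (if g = h then 1 else 0 : ℝ) • a := by
  rw [GradedAlgebra.proj_apply, DirectSum.decompose_of_mem 𝒜 ha, DirectSum.coe_of_apply]
  split_ifs <;> simp

lemma commute_proj_of_map_mem {f : Module.End ℝ R} (hf : ∀ g, ∀ a ∈ 𝒜 g, f a ∈ 𝒜 g) (h : G) :
    Commute f (GradedAlgebra.proj 𝒜 h) := by
  refine LinearMap.ext fun a => ?_
  induction a using DirectSum.Decomposition.inductionOn 𝒜 with
  | zero => simp only [map_zero]
  | @homogeneous g a =>
    simp only [Module.End.mul_apply, proj_of_mem a.2, proj_of_mem (hf g a a.2), map_smul]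
  | add a b ha hb => rw [map_add, map_add, ha, hb]

lemma iSupIndep_inf_eigenspace {σ : Type*} {f : Module.End ℝ R}
    (hf : ∀ g, ∀ a ∈ 𝒜 g, f a ∈ 𝒜 g) {μ : σ → ℝ} (hμ : Function.Injective μ) :
    iSupIndep fun p : G × σ => 𝒜 p.1 ⊓ f.eigenspace (μ p.2) := by
  let F : Option G → Module.End ℝ R := fun o => o.elim f (GradedAlgebra.proj 𝒜)
  let χ : G × σ → Option G → ℝ := fun p o => o.elim (μ p.2) fun h => if p.1 = h then 1 else 0
  have commute (i j : Option G) : Commute (F i) (F j) := by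
    have proj_mem (h g : G) (a : R) (ha : a ∈ 𝒜 g) : GradedAlgebra.proj 𝒜 h a ∈ 𝒜 g := by
      rw [proj_of_mem ha]
      exact Submodule.smul_mem _ _ ha
    rcases i with _ | g <;> rcases j with _ | h
    exacts [Commute.refl f, commute_proj_of_map_mem hf h, (commute_proj_of_map_mem hf g).symm,
      commute_proj_of_map_mem (proj_mem g) h]
  refine iSupIndep_of_joint_eigenvectors commute (χ := χ) ?_ ?_
  · rintro ⟨g, s⟩ ⟨h, t⟩ hχ
    have hs : s = t := hμ (congrFun hχ none)
    have hg : h = g := by simpa [χ] using congrFun hχ (some g)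
    rw [hs, hg]
  · rintro ⟨g, s⟩ a ⟨ha, ha'⟩ (_ | h)
    exacts [Module.End.mem_eigenspace_iff.1 ha', proj_of_mem ha h]

lemma nonempty_gradedAlgebra_inf_eigenspace {f : R →ₐ[ℝ] R} (hff : ∀ a, f (f a) = a)
    (hf : ∀ g, ∀ a ∈ 𝒜 g, f a ∈ 𝒜 g) :
    Nonempty (GradedAlgebra fun p : G × ZMod 2 =>
      𝒜 p.1 ⊓ Module.End.eigenspace f.toLinearMap (signChar ℝ p.2)) := by
  have mem_iff (s : ZMod 2) (a : R) : a ∈ Module.End.eigenspace f.toLinearMap (signChar ℝ s) ↔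
      f a = signChar ℝ s • a := Module.End.mem_eigenspace_iff
  set ℬ : G × ZMod 2 → Submodule ℝ R := fun p =>
    𝒜 p.1 ⊓ Module.End.eigenspace f.toLinearMap (signChar ℝ p.2)
  have gradedMonoid : SetLike.GradedMonoid ℬ :=
    { one_mem := ⟨SetLike.GradedOne.one_mem, (mem_iff 0 1).2 (by simp)⟩
      mul_mem := by
        rintro ⟨g, s⟩ ⟨h, t⟩ a b ⟨ha, ha'⟩ ⟨hb, hb'⟩
        refine ⟨SetLike.GradedMul.mul_mem ha hb, (mem_iff (s + t) _).2 ?_⟩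
        rw [map_mul, (mem_iff s a).1 ha', (mem_iff t b).1 hb', smul_mul_smul_comm,
          AddChar.map_add_eq_mul] }
  have indep : iSupIndep ℬ := iSupIndep_inf_eigenspace hf (signChar_injective ℝ)
  have iSup_eq_top : ⨆ p, ℬ p = ⊤ := by
    rw [eq_top_iff, ← (DirectSum.Decomposition.isInternal 𝒜).submodule_iSup_eq_top]
    refine iSup_le fun g a ha => ?_
    have average : (2⁻¹ : ℝ) • (a + f a) + (2⁻¹ : ℝ) • (a - f a) = a := by module
    rw [← average]
    have hfa := hf g a ha
    refine add_mem (le_iSup ℬ (g, 0) ⟨Submodule.smul_mem _ _ (add_mem ha hfa), ?_⟩)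
      (le_iSup ℬ (g, 1) ⟨Submodule.smul_mem _ _ (sub_mem ha hfa), ?_⟩)
    · refine (mem_iff 0 _).2 ?_
      rw [map_smul, map_add, hff, AddChar.map_zero_eq_one]
      module
    · refine (mem_iff 1 _).2 ?_
      rw [map_smul, map_sub, hff, signChar_one]
      module
  exact ⟨{ gradedMonoid, (DirectSum.isInternal_submodule_of_iSupIndep_of_iSup_eq_top indep
    iSup_eq_top).chooseDecomposition with }⟩

/-- The eigenspaces of `f` would refine the grading. -/
lemma IsFineGrading.eq_or_eq_neg_of_involutive (h𝒜 : IsFineGrading 𝒜) {f : R →ₐ[ℝ] R}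
    (hff : ∀ a, f (f a) = a) (hf : ∀ g, ∀ a ∈ 𝒜 g, f a ∈ 𝒜 g) (g : G) :
    (∀ a ∈ 𝒜 g, f a = a) ∨ ∀ a ∈ 𝒜 g, f a = -a := by
  by_contra! h
  obtain ⟨⟨a, ha, hfa⟩, b, hb, hfb⟩ := h
  obtain ⟨_⟩ := nonempty_gradedAlgebra_inf_eigenspace hff hf
  refine h𝒜 (G × ZMod 2)
    (fun p => 𝒜 p.1 ⊓ Module.End.eigenspace f.toLinearMap (signChar ℝ p.2))
    ⟨fun p => ⟨p.1, inf_le_left⟩, (g, 0), ?_, g, inf_le_left, fun hle => ?_⟩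
  · refine (Submodule.ne_bot_iff _).2 ⟨b + f b, ⟨add_mem hb (hf g b hb), ?_⟩, fun h0 => ?_⟩
    · refine Module.End.mem_eigenspace_iff.2 ?_
      simp [hff, add_comm]
    · exact hfb (eq_neg_of_add_eq_zero_right h0)
  · have fixed := Module.End.mem_eigenspace_iff.1 (hle ha).2
    rw [AddChar.map_zero_eq_one, one_smul] at fixed
    exact hfa fixed

lemma IsFineGrading.mul_eq_or_eq_neg_mul (h𝒜 : IsFineGrading 𝒜) {g : G} {u : Rˣ}
    (hu : (u : R) ∈ 𝒜 g) (hu2 : ∀ a : R, u * u * a = a * (u * u)) (k : G) :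
    (∀ a ∈ 𝒜 k, u * a = a * u) ∨ ∀ a ∈ 𝒜 k, u * a = -(a * u) := by
  set f : R →ₐ[ℝ] R := MulSemiringAction.toAlgHom ℝ R (ConjAct.toConjAct u)
  have f_apply (a : R) : f a = u * a * ↑u⁻¹ := rfl
  have involutive (a : R) : f (f a) = a := by
    rw [f_apply, f_apply, Units.mul_inv_eq_iff_eq_mul, ← mul_assoc, ← mul_assoc,
      Units.mul_inv_eq_iff_eq_mul, hu2, mul_assoc]
  have degree_preserving (k : G) (a : R) (ha : a ∈ 𝒜 k) : f a ∈ 𝒜 k := by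
    have := SetLike.GradedMul.mul_mem (SetLike.GradedMul.mul_mem hu ha) (inv_mem_graded_neg hu)
    rwa [add_neg_cancel_comm] at this
  simpa only [f_apply, Units.mul_inv_eq_iff_eq_mul, neg_mul] using
    h𝒜.eq_or_eq_neg_of_involutive involutive degree_preserving k

end Fine

lemma exists_algebraMap_or_exists_mul_self_eq_neg_one {D : Type*} [Ring D] [IsDomain D]
    [Algebra ℝ D] [FiniteDimensional ℝ D] (c : D) :
    (∃ r : ℝ, c = algebraMap ℝ D r) ∨
      ∃ i : D, i * i = -1 ∧ ∃ p q : ℝ, c = algebraMap ℝ D p + q • i := by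
  have := Algebra.isMulCommutative_adjoin ℝ (s := {c}) (by simp)
  let _ : Field (Algebra.adjoin ℝ {c}) := fieldOfFiniteDimensional ℝ _
  let c' : Algebra.adjoin ℝ {c} := ⟨c, Algebra.self_mem_adjoin_singleton ℝ c⟩
  rcases Real.nonempty_algEquiv_or (Algebra.adjoin ℝ {c}) with ⟨⟨φ⟩⟩ | ⟨⟨φ⟩⟩
  · refine Or.inl ⟨φ c', ?_⟩
    have eq_algebraMap : c' = algebraMap ℝ _ (φ c') := by
      rw [← φ.symm.commutes, Algebra.algebraMap_self_apply, φ.symm_apply_apply]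
    exact congrArg Subtype.val eq_algebraMap
  · refine Or.inr ⟨φ.symm Complex.I, ?_, (φ c').re, (φ c').im, ?_⟩
    · have sq_I : φ.symm Complex.I * φ.symm Complex.I = -1 := by
        rw [← map_mul, Complex.I_mul_I, map_neg, map_one]
      exact congrArg Subtype.val sq_I
    · have re_add_im : c' = algebraMap ℝ _ (φ c').re + (φ c').im • φ.symm Complex.I := by
        rw [← map_smul, ← φ.symm.commutes, ← map_add, Complex.real_smul, Complex.coe_algebraMap,
          Complex.re_add_im, φ.symm_apply_apply]
      exact congrArg Subtype.val re_add_im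

lemma pow_finrank_eq_one_of_mul_eq_smul_mul {K A : Type*} [Field K] [Ring A] [Algebra K A]
    [FiniteDimensional K A] {a b : Aˣ} {r : K} (h : (a * b : A) = r • (b * a : A)) :
    r ^ Module.finrank K A = 1 := by
  have norm_ne_zero : Algebra.norm K (b * a : A) ≠ 0 :=
    (((b * a).isUnit).map (Algebra.norm K)).ne_zero
  refine mul_right_cancel₀ norm_ne_zero ?_
  rw [← Algebra.norm_algebraMap (S := A), ← map_mul, ← Algebra.smul_def, ← h, one_mul, map_mul,
    map_mul, mul_comm]

lemma abs_eq_one_of_mul_eq_smul_mul {A : Type*} [Ring A] [Nontrivial A] [Algebra ℝ A]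
    [FiniteDimensional ℝ A] {a b : Aˣ} {r : ℝ} (h : (a * b : A) = r • (b * a : A)) : |r| = 1 := by
  refine (pow_eq_one_iff_of_nonneg (abs_nonneg r) (Module.finrank_pos (R := ℝ) (M := A)).ne').1 ?_
  rw [← abs_pow, pow_finrank_eq_one_of_mul_eq_smul_mul h, abs_one]

section Division

variable {G : Type u} [AddCommGroup G] [DecidableEq G] {R : Type v} [Ring R] [Algebra ℝ R]
  {𝒜 : G → Submodule ℝ R} [GradedAlgebra 𝒜]

variable (𝒜) in
lemma mem_one_of_forall_homogeneous_commute [Algebra.IsCentral ℝ R] {x : R}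
    (h : ∀ g, ∀ a ∈ 𝒜 g, x * a = a * x) : x ∈ (1 : Submodule ℝ R) := by
  rw [← Algebra.toSubmodule_bot, ← Algebra.IsCentral.center_eq_bot ℝ R,
    Subalgebra.mem_toSubmodule, Subalgebra.mem_center_iff]
  intro a
  induction a using DirectSum.Decomposition.inductionOn 𝒜 with
  | zero => rw [zero_mul, mul_zero]
  | homogeneous a => exact (h _ a a.2).symm
  | add a b ha hb => rw [add_mul, mul_add, ha, hb]

lemma IsDivisionGrading.exists_unit_mem (hd : IsDivisionGrading 𝒜)
    (hs : AddSubgroup.closure (gradingSupport 𝒜) = ⊤) (g : G) : ∃ u : Rˣ, (u : R) ∈ 𝒜 g := by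
  have hg : g ∈ AddSubgroup.closure (gradingSupport 𝒜) := hs ▸ AddSubgroup.mem_top g
  induction hg using AddSubgroup.closure_induction with
  | mem g hg =>
    obtain ⟨a, ha, ha0⟩ := (Submodule.ne_bot_iff _).1 hg
    obtain ⟨u, rfl⟩ := hd g a ha ha0
    exact ⟨u, ha⟩
  | zero => exact ⟨1, SetLike.GradedOne.one_mem⟩
  | add g h _ _ hg hh =>
    obtain ⟨u, hu⟩ := hg
    obtain ⟨v, hv⟩ := hh
    exact ⟨u * v, SetLike.GradedMul.mul_mem hu hv⟩
  | neg g _ hg =>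
    obtain ⟨u, hu⟩ := hg
    exact ⟨u⁻¹, inv_mem_graded_neg hu⟩

lemma finite_of_forall_exists_unit_mem [Nontrivial R] [FiniteDimensional ℝ R]
    (h : ∀ g, ∃ u : Rˣ, (u : R) ∈ 𝒜 g) : Finite G := by
  have finite_support := WellFoundedGT.finite_ne_bot_of_iSupIndep
    (DirectSum.Decomposition.isInternal 𝒜).submodule_iSupIndep
  rw [Set.eq_univ_of_forall (s := {g | 𝒜 g ≠ ⊥}) fun g => ?_] at finite_support
  · exact Set.finite_univ_iff.1 finite_support
  · obtain ⟨u, hu⟩ := h g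
    exact (Submodule.ne_bot_iff _).2 ⟨u, hu, u.ne_zero⟩

lemma exists_commutator_mem_zero {g h : G} {u v : Rˣ} (hu : (u : R) ∈ 𝒜 g) (hv : (v : R) ∈ 𝒜 h) :
    ∃ c ∈ 𝒜 0, (u * v : R) = c * (v * u) := by
  refine ⟨u * v * ↑(v * u)⁻¹, ?_, ?_⟩
  · have hvu : (↑(v * u) : R) ∈ 𝒜 (g + h) := add_comm h g ▸ SetLike.GradedMul.mul_mem hv hu
    exact add_neg_cancel (g + h) ▸
      SetLike.GradedMul.mul_mem (SetLike.GradedMul.mul_mem hu hv) (inv_mem_graded_neg hvu)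
  · rw [← Units.val_mul v u, Units.inv_mul_cancel_right]

lemma IsDivisionGrading.isDomain_zero [Nontrivial R] (hd : IsDivisionGrading 𝒜) :
    IsDomain (𝒜 0) := by
  have : Nontrivial (𝒜 0) := ⟨0, 1, fun h => zero_ne_one (congrArg Subtype.val h)⟩
  have : NoZeroDivisors (𝒜 0) := ⟨fun {a b} hab => or_iff_not_imp_left.2 fun ha =>
    Subtype.ext <| (hd 0 a a.2 (Subtype.coe_ne_coe.2 ha)).mul_right_eq_zero.1
      (congrArg Subtype.val hab)⟩
  exact NoZeroDivisors.to_isDomain _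

lemma IsDivisionGrading.mem_one_or_exists_mul_self_eq_neg_one [Nontrivial R]
    [FiniteDimensional ℝ R] (hd : IsDivisionGrading 𝒜) {c : R} (hc : c ∈ 𝒜 0) :
    c ∈ (1 : Submodule ℝ R) ∨
      ∃ i ∈ 𝒜 0, i * i = -1 ∧ ∃ p q : ℝ, c = algebraMap ℝ R p + q • i := by
  have := hd.isDomain_zero
  rcases exists_algebraMap_or_exists_mul_self_eq_neg_one (⟨c, hc⟩ : 𝒜 0) with
    ⟨r, hr⟩ | ⟨i, hi, p, q, hpq⟩
  · exact Or.inl (Submodule.mem_one.2 ⟨r, (congrArg Subtype.val hr).symm⟩)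
  · exact Or.inr ⟨i, i.2, congrArg Subtype.val hi, p, q, congrArg Subtype.val hpq⟩

lemma IsFineGrading.commute_of_mem_zero [Nontrivial R] (h𝒜 : IsFineGrading 𝒜) {g : G} {u : Rˣ}
    (hu : (u : R) ∈ 𝒜 g) (hu2 : ∀ a : R, u * u * a = a * (u * u)) {a : R} (ha : a ∈ 𝒜 0) :
    u * a = a * u := by
  have : IsAddTorsionFree R := .of_isTorsionFree ℝ R
  refine (h𝒜.mul_eq_or_eq_neg_mul hu hu2 0).resolve_right (fun h => ?_) a ha
  have hneg := h 1 SetLike.GradedOne.one_mem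
  rw [mul_one, one_mul, self_eq_neg] at hneg
  exact u.ne_zero hneg

lemma IsFineGrading.exists_eq_algebraMap_add_smul [Nontrivial R] [FiniteDimensional ℝ R]
    (h𝒜 : IsFineGrading 𝒜) (hd : IsDivisionGrading 𝒜) {i : Rˣ} (hi : (i : R) ∈ 𝒜 0)
    (hii : (i * i : R) = -1) {c : R} (hc : c ∈ 𝒜 0) :
    ∃ p q : ℝ, c = algebraMap ℝ R p + q • (i : R) := by
  rcases hd.mem_one_or_exists_mul_self_eq_neg_one hc with h | ⟨j, hj, hjj, p, q, hpq⟩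
  · obtain ⟨r, rfl⟩ := Submodule.mem_one.1 h
    exact ⟨r, 0, by rw [zero_smul, add_zero]⟩
  have commute_ij : Commute (i : R) j :=
    h𝒜.commute_of_mem_zero hi (fun a => by rw [hii, neg_one_mul, mul_neg_one]) hj
  have := hd.isDomain_zero
  have eq_or_eq_neg : (⟨j, hj⟩ : 𝒜 0) = ⟨i, hi⟩ ∨ (⟨j, hj⟩ : 𝒜 0) = -⟨i, hi⟩ := by
    refine Commute.mul_self_eq_mul_self_iff (Subtype.ext commute_ij.symm.eq) |>.1 (Subtype.ext ?_)
    exact hjj.trans hii.symm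
  rcases eq_or_eq_neg with h | h
  · exact ⟨p, q, by rw [hpq, show j = i from congrArg Subtype.val h]⟩
  · exact ⟨p, -q, by rw [hpq, show j = -i from congrArg Subtype.val h, smul_neg, neg_smul]⟩

/-- Write `u v = c v u` with `c = p + q i`. Moving `u` past `c` conjugates it, so that
`u² v = (p² + q²) v u²`, and the norm forces `p² + q² = 1`. -/
lemma mul_self_mul_eq_mul_mul_self_of_anticommute [Nontrivial R] [FiniteDimensional ℝ R] {i : R}
    (hii : i * i = -1) (h0 : ∀ c ∈ 𝒜 0, ∃ p q : ℝ, c = algebraMap ℝ R p + q • i) {g h : G}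
    {u v : Rˣ} (hu : (u : R) ∈ 𝒜 g) (hv : (v : R) ∈ 𝒜 h) (hui : u * i = -(i * u)) :
    (u * u * v : R) = v * (u * u) := by
  obtain ⟨c, hc, huv⟩ := exists_commutator_mem_zero hu hv
  obtain ⟨p, q, rfl⟩ := h0 c hc
  have conj : u * (algebraMap ℝ R p + q • i) = (algebraMap ℝ R p - q • i) * u := by
    rw [mul_add, sub_mul, mul_smul_comm, hui, smul_mul_assoc, Algebra.commutes, smul_neg,
      sub_eq_add_neg]
  have norm_sq : (algebraMap ℝ R p - q • i) * (algebraMap ℝ R p + q • i) =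
      algebraMap ℝ R (p ^ 2 + q ^ 2) := by
    simp only [sub_mul, mul_add, smul_mul_assoc, mul_smul_comm, hii,
      Algebra.algebraMap_eq_smul_one, one_mul, mul_one]
    module
  have mul_self_mul : (↑(u * u) * v : R) = (p ^ 2 + q ^ 2) • (v * ↑(u * u) : R) := by
    calc (↑(u * u) * v : R) = u * (u * v) := by rw [Units.val_mul, mul_assoc]
      _ = u * (algebraMap ℝ R p + q • i) * v * u := by rw [huv]; simp only [mul_assoc]
      _ = (algebraMap ℝ R p - q • i) * (u * v) * u := by rw [conj, mul_assoc _ (u : R)]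
      _ = (p ^ 2 + q ^ 2) • (v * ↑(u * u) : R) := by
        rw [huv, ← mul_assoc, norm_sq, Algebra.smul_def, Units.val_mul]
        simp only [mul_assoc]
  have norm_eq_one := abs_eq_one_of_mul_eq_smul_mul mul_self_mul
  rw [abs_of_nonneg (by positivity)] at norm_eq_one
  rwa [norm_eq_one, one_smul, Units.val_mul] at mul_self_mul

lemma IsFineGrading.exists_anticommute [Algebra.IsCentral ℝ R] (h𝒜 : IsFineGrading 𝒜) {g : G}
    {u : Rˣ} (hu : (u : R) ∈ 𝒜 g) (hu2 : ∀ a : R, u * u * a = a * (u * u))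
    (hu1 : (u : R) ∉ (1 : Submodule ℝ R)) : ∃ k, ∀ a ∈ 𝒜 k, u * a = -(a * u) := by
  by_contra! h
  refine hu1 (mem_one_of_forall_homogeneous_commute 𝒜 fun k => ?_)
  refine (h𝒜.mul_eq_or_eq_neg_mul hu hu2 k).resolve_right fun hk => ?_
  obtain ⟨a, ha, hne⟩ := h k
  exact hne (hk a ha)

theorem IsFineGrading.zero_le_one [Nontrivial R] [FiniteDimensional ℝ R] [Algebra.IsCentral ℝ R]
    (h𝒜 : IsFineGrading 𝒜) (hd : IsDivisionGrading 𝒜)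
    (hs : AddSubgroup.closure (gradingSupport 𝒜) = ⊤) : 𝒜 0 ≤ 1 := by
  intro c hc
  refine (hd.mem_one_or_exists_mul_self_eq_neg_one hc).resolve_right ?_
  rintro ⟨i, hi, hii, -⟩
  obtain ⟨i, rfl⟩ : IsUnit i := hd 0 i hi (by rintro rfl; simp at hii)
  have hi2 (a : R) : i * i * a = a * (i * i) := by rw [hii, neg_one_mul, mul_neg_one]
  have not_real : (i : R) ∉ (1 : Submodule ℝ R) := fun h => by
    obtain ⟨r, hr⟩ := Submodule.mem_one.1 h
    rw [← hr, ← map_mul, ← map_one (algebraMap ℝ R), ← map_neg] at hii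
    linarith [mul_self_nonneg r, (algebraMap ℝ R).injective hii]
  obtain ⟨g, hg⟩ := h𝒜.exists_anticommute hi hi2 not_real
  obtain ⟨u, hu⟩ := hd.exists_unit_mem hs g
  have anticommute_i : (u * i : R) = -(i * u) := by rw [hg u hu, neg_neg]
  have sq_central : (u * u : R) ∈ (1 : Submodule ℝ R) :=
    mem_one_of_forall_homogeneous_commute 𝒜 fun h a ha => by
      rcases eq_or_ne a 0 with rfl | ha0
      · rw [mul_zero, zero_mul]
      obtain ⟨v, rfl⟩ := hd h a ha ha0
      exact mul_self_mul_eq_mul_mul_self_of_anticommute hii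
        (fun c hc => h𝒜.exists_eq_algebraMap_add_smul hd hi hii hc) hu ha anticommute_i
  obtain ⟨r, hr⟩ := Submodule.mem_one.1 sq_central
  have commute_i := h𝒜.commute_of_mem_zero hu
    (fun a => by rw [← hr, Algebra.commutes]) hi
  have : IsAddTorsionFree R := .of_isTorsionFree ℝ R
  rw [anticommute_i, neg_eq_self] at commute_i
  exact (i * u).ne_zero commute_i

end Division

section RealIdentityComponent

variable {G : Type*} [AddCommGroup G] [DecidableEq G] {R : Type*} [Ring R]
  [Algebra ℝ R] {𝒜 : G → Submodule ℝ R} [GradedAlgebra 𝒜]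

lemma eq_span_singleton_of_unit_mem (h0 : 𝒜 0 ≤ 1) {g : G} {u : Rˣ} (hu : (u : R) ∈ 𝒜 g) :
    𝒜 g = Submodule.span ℝ {(u : R)} := by
  refine le_antisymm (fun a ha => ?_) ((Submodule.span_singleton_le_iff_mem _ _).2 hu)
  have inv_mul_mem : ↑u⁻¹ * a ∈ 𝒜 0 :=
    neg_add_cancel g ▸ SetLike.GradedMul.mul_mem (inv_mem_graded_neg hu) ha
  obtain ⟨r, hr⟩ := Submodule.mem_one.1 (h0 inv_mul_mem)
  refine Submodule.mem_span_singleton.2 ⟨r, ?_⟩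
  rw [Algebra.smul_def, Algebra.commutes, hr, Units.mul_inv_cancel_left]

variable [Nontrivial R]

lemma finrank_eq_one_of_unit_mem (h0 : 𝒜 0 ≤ 1) {g : G} {u : Rˣ} (hu : (u : R) ∈ 𝒜 g) :
    Module.finrank ℝ (𝒜 g) = 1 := by
  rw [eq_span_singleton_of_unit_mem h0 hu, finrank_span_singleton u.ne_zero]

lemma exists_mul_eq_signChar_smul_mul [FiniteDimensional ℝ R] (h0 : 𝒜 0 ≤ 1) {g h : G} {u v : Rˣ}
    (hu : (u : R) ∈ 𝒜 g) (hv : (v : R) ∈ 𝒜 h) :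
    ∃ t : ZMod 2, (u * v : R) = signChar ℝ t • (v * u : R) := by
  obtain ⟨c, hc, huv⟩ := exists_commutator_mem_zero hu hv
  obtain ⟨r, rfl⟩ := Submodule.mem_one.1 (h0 hc)
  rw [← Algebra.smul_def] at huv
  rcases eq_or_eq_neg_of_abs_eq (abs_eq_one_of_mul_eq_smul_mul huv) with rfl | rfl
  · exact ⟨0, by rw [huv, AddChar.map_zero_eq_one]⟩
  · exact ⟨1, by rw [huv, signChar_one]⟩

lemma IsDivisionGrading.mul_self_mem_one [FiniteDimensional ℝ R] [Algebra.IsCentral ℝ R]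
    (hd : IsDivisionGrading 𝒜) (h0 : 𝒜 0 ≤ 1) {g : G} {u : Rˣ} (hu : (u : R) ∈ 𝒜 g) :
    (u * u : R) ∈ (1 : Submodule ℝ R) :=
  mem_one_of_forall_homogeneous_commute 𝒜 fun h a ha => by
    rcases eq_or_ne a 0 with rfl | ha0
    · rw [mul_zero, zero_mul]
    obtain ⟨v, rfl⟩ := hd h a ha ha0
    obtain ⟨t, ht⟩ := exists_mul_eq_signChar_smul_mul h0 hu ha
    rw [mul_assoc, ht, mul_smul_comm, ← mul_assoc, ht, smul_mul_assoc, smul_smul,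
      ← AddChar.map_add_eq_mul, CharTwo.add_self_eq_zero, AddChar.map_zero_eq_one, one_smul,
      mul_assoc]

lemma IsDivisionGrading.add_self_eq_zero [FiniteDimensional ℝ R] [Algebra.IsCentral ℝ R]
    (hd : IsDivisionGrading 𝒜) (h0 : 𝒜 0 ≤ 1) {g : G} {u : Rˣ} (hu : (u : R) ∈ 𝒜 g) :
    g + g = 0 := by
  have one_le_zero : (1 : Submodule ℝ R) ≤ 𝒜 0 := Submodule.one_le.2 SetLike.GradedOne.one_mem
  exact DirectSum.degree_eq_of_mem_mem 𝒜 (SetLike.GradedMul.mul_mem hu hu)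
    (one_le_zero (hd.mul_self_mem_one h0 hu)) (u * u).ne_zero

end RealIdentityComponent

lemma exists_sq_smul_eq_neg_one_or_one {A : Type*} [Ring A] [Algebra ℝ A] {a : A} {r : ℝ}
    (hr : r ≠ 0) (ha : a * a = algebraMap ℝ A r) :
    ∃ t σ : ℝ, (σ = -1 ∨ σ = 1) ∧ (t • a) * (t • a) = algebraMap ℝ A σ := by
  refine ⟨(√|r|)⁻¹, r / |r|, ?_, ?_⟩
  · rcases abs_choice r with h | h
    · right; rw [h, div_self hr]
    · left; rw [h, div_neg, div_self hr]
  · rw [smul_mul_smul_comm, ha, Algebra.smul_def, ← map_mul, ← mul_inv,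
      Real.mul_self_sqrt (abs_nonneg r), div_eq_inv_mul]

/-! ### Chiral systems -/

lemma IsAnticommSystem.sum_elim {ι κ K R : Type*} [Field K] [Ring R] [Algebra K R] {ε : ι → K}
    {x : ι → R} {δ : κ → K} {y : κ → R} {ω : R} {s : K} (h : IsAnticommSystem ε x)
    (h' : IsAnticommSystem δ y)
    (hs : s ≠ 0) (hω : ω * ω = algebraMap K R s) (hωx : ∀ i, ω * x i = -(x i * ω))
    (hyx : ∀ j i, Commute (y j) (x i)) (hyω : ∀ j, Commute (y j) ω) :
    IsAnticommSystem (Sum.elim ε (s • δ)) (Sum.elim x fun j => ω * y j) where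
  sq
    | .inl i => h.sq i
    | .inr j => by
      simp only [Sum.elim_inr, Pi.smul_apply, smul_eq_mul, map_mul]
      rw [(hyω j).mul_mul_mul_comm, hω, h'.sq]
  anticomm
    | .inl i, .inl i', hi => h.anticomm i i' (by simpa using hi)
    | .inl i, .inr j, _ => by
      simp only [Sum.elim_inl, Sum.elim_inr]
      rw [mul_assoc, (hyx j i).eq, ← mul_assoc ω, hωx, neg_mul, neg_neg, mul_assoc]
    | .inr j, .inl i, _ => by
      simp only [Sum.elim_inl, Sum.elim_inr]
      rw [mul_assoc, (hyx j i).eq, ← mul_assoc, hωx, neg_mul, mul_assoc]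
    | .inr j, .inr j', hj => by
      simp only [Sum.elim_inr]
      rw [(hyω j).mul_mul_mul_comm, h'.anticomm j j' (by simpa using hj),
        (hyω j').mul_mul_mul_comm, mul_neg]
  ne_zero
    | .inl i => h.ne_zero i
    | .inr j => mul_ne_zero hs (h'.ne_zero j)

/-- An anticommuting system with squares `±1` together with a chirality element: an element `ω` of
the subalgebra generated by the system that anticommutes with its members and has square `s = ±1`.
The balance condition `∑ i, ε i = s - 1` makes `s` determine the number of negative squares; the
system then generates a matrix algebra over `ℝ` for `s = 1` and over `ℍ` for `s = -1`. -/
structure IsChiralSystem {ι R : Type*} [Fintype ι] [Ring R] [Algebra ℝ R] (ε : ι → ℝ) (x : ι → R)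
    (ω : R) (s : ℝ) : Prop extends IsAnticommSystem ε x where
  sign (i : ι) : ε i = -1 ∨ ε i = 1
  chirality_sign : s = -1 ∨ s = 1
  chirality_sq : ω * ω = algebraMap ℝ R s
  chirality_anticomm (i : ι) : ω * x i = -(x i * ω)
  chirality_mem_adjoin : ω ∈ Algebra.adjoin ℝ (Set.range x)
  balance : ∑ i, ε i = s - 1

section ChiralSystems

variable {ι κ R : Type*} [Ring R] [Algebra ℝ R] {ε : ι → ℝ} {x : ι → R} {δ : κ → ℝ} {y : κ → R}
  {ω ζ : R} {s τ : ℝ}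

lemma mul_eq_neg_one_or_one {a b : ℝ} (ha : a = -1 ∨ a = 1) (hb : b = -1 ∨ b = 1) :
    a * b = -1 ∨ a * b = 1 := by
  rcases ha with rfl | rfl <;> rcases hb with rfl | rfl <;> norm_num

lemma ne_zero_of_eq_neg_one_or_one {a : ℝ} (ha : a = -1 ∨ a = 1) : a ≠ 0 := by
  rcases ha with rfl | rfl <;> norm_num

lemma adjoin_range_le_adjoin_range_sum_elim :
    Algebra.adjoin ℝ (Set.range x) ≤ Algebra.adjoin ℝ (Set.range (Sum.elim x y)) :=
  Algebra.adjoin_mono (by rw [Set.Sum.elim_range]; exact Set.subset_union_left)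

lemma commute_of_mem_adjoin_range (h : ∀ i, Commute ζ (x i))
    (hω : ω ∈ Algebra.adjoin ℝ (Set.range x)) : Commute ζ ω :=
  Algebra.commute_of_mem_adjoin_of_forall_mem_commute hω (by rintro _ ⟨i, rfl⟩; exact h i)

namespace IsChiralSystem

variable [Fintype ι]

lemma mem_adjoin_sum_elim (h : IsChiralSystem ε x ω s) (j : κ) :
    y j ∈ Algebra.adjoin ℝ (Set.range (Sum.elim x fun j => ω * y j)) := by
  set A := Algebra.adjoin ℝ (Set.range (Sum.elim x fun j => ω * y j))
  have ω_mem : ω ∈ A := adjoin_range_le_adjoin_range_sum_elim h.chirality_mem_adjoin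
  have ω_mul_y_mem : ω * y j ∈ A := Algebra.subset_adjoin ⟨.inr j, rfl⟩
  have smul_mem : s • y j ∈ A := by
    rw [Algebra.smul_def, ← h.chirality_sq, mul_assoc]
    exact mul_mem ω_mem ω_mul_y_mem
  rw [← inv_smul_smul₀ (ne_zero_of_eq_neg_one_or_one h.chirality_sign) (y j)]
  exact A.smul_mem smul_mem s⁻¹

/-- The balance is preserved because `(s - 1) + s * (τ - 1) = s * τ - 1`. -/
lemma sum_elim [Fintype κ] (h : IsChiralSystem ε x ω s) (h' : IsChiralSystem δ y ζ τ)
    (hyx : ∀ j i, Commute (y j) (x i)) :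
    IsChiralSystem (Sum.elim ε (s • δ)) (Sum.elim x fun j => ω * y j) (ω * ζ) (s * τ) := by
  have ζ_comm (i : ι) : Commute (x i) ζ :=
    commute_of_mem_adjoin_range (fun j => (hyx j i).symm) h'.chirality_mem_adjoin
  have ω_comm (j : κ) : Commute (y j) ω :=
    commute_of_mem_adjoin_range (hyx j) h.chirality_mem_adjoin
  have ωζ_comm : Commute ζ ω :=
    commute_of_mem_adjoin_range (fun i => (ζ_comm i).symm) h.chirality_mem_adjoin
  exact
  { toIsAnticommSystem := h.toIsAnticommSystem.sum_elim h'.toIsAnticommSystem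
      (ne_zero_of_eq_neg_one_or_one h.chirality_sign) h.chirality_sq h.chirality_anticomm hyx ω_comm
    sign
      | .inl i => h.sign i
      | .inr j => mul_eq_neg_one_or_one h.chirality_sign (h'.sign j)
    chirality_sign := mul_eq_neg_one_or_one h.chirality_sign h'.chirality_sign
    chirality_sq := by
      rw [ωζ_comm.mul_mul_mul_comm, h.chirality_sq, h'.chirality_sq, map_mul]
    chirality_anticomm
      | .inl i => by
        simp only [Sum.elim_inl]
        rw [mul_assoc, ← (ζ_comm i).eq, ← mul_assoc, h.chirality_anticomm, neg_mul, mul_assoc]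
      | .inr j => by
        simp only [Sum.elim_inr]
        rw [ωζ_comm.mul_mul_mul_comm, h'.chirality_anticomm, (ω_comm j).mul_mul_mul_comm, mul_neg]
    chirality_mem_adjoin := mul_mem
      (adjoin_range_le_adjoin_range_sum_elim h.chirality_mem_adjoin)
      (Algebra.adjoin_le (by rintro _ ⟨j, rfl⟩; exact h.mem_adjoin_sum_elim j)
        h'.chirality_mem_adjoin)
    balance := by
      simp only [Fintype.sum_sum_type, Sum.elim_inl, Sum.elim_inr, Pi.smul_apply, smul_eq_mul,
        ← Finset.mul_sum, h.balance, h'.balance]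
      ring }

lemma even_card (h : IsChiralSystem ε x ω s) : Even (Fintype.card ι) := by
  have card_negative := two_mul_card_fiber_of_sign h.sign (.inl rfl)
  set N := Fintype.card {i // ε i = -1}
  rw [h.balance] at card_negative
  rcases h.chirality_sign with rfl | rfl
  · have card_add_two : Fintype.card ι + 2 = 2 * N := by
      exact_mod_cast (by linarith : (Fintype.card ι + 2 : ℝ) = 2 * N)
    exact ⟨N - 1, by lia⟩
  · exact ⟨N, by exact_mod_cast (by linarith : (Fintype.card ι : ℝ) = N + N)⟩

end IsChiralSystem

lemma isAnticommSystem_pair {a b : R} {α β : ℝ} (hα : α ≠ 0) (hβ : β ≠ 0)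
    (ha : a * a = algebraMap ℝ R α) (hb : b * b = algebraMap ℝ R β) (hab : a * b = -(b * a)) :
    IsAnticommSystem ![α, β] ![a, b] where
  sq := Fin.forall_fin_two.2 ⟨ha, hb⟩
  anticomm := by simp [Fin.forall_fin_two, hab]
  ne_zero := Fin.forall_fin_two.2 ⟨hα, hβ⟩

lemma isChiralSystem_pair {a b : R} {β : ℝ} (hβ : β = -1 ∨ β = 1) (ha : a * a = algebraMap ℝ R (-1))
    (hb : b * b = algebraMap ℝ R β) (hab : a * b = -(b * a)) :
    IsChiralSystem ![-1, β] ![a, b] (a * b) β where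
  toIsAnticommSystem := isAnticommSystem_pair (by norm_num) (ne_zero_of_eq_neg_one_or_one hβ)
    ha hb hab
  sign := by simpa [Fin.forall_fin_two] using hβ
  chirality_sign := hβ
  chirality_sq := by
    rw [← mul_assoc, mul_assoc a, ← neg_eq_iff_eq_neg.2 hab,
      mul_neg, ← mul_assoc, ha]
    simp [hb]
  chirality_anticomm := by
    simp only [Fin.forall_fin_two, Matrix.cons_val_zero, Matrix.cons_val_one]
    constructor
    · rw [mul_assoc, ← neg_eq_iff_eq_neg.2 hab, mul_neg]
    · rw [← mul_assoc, ← neg_mul, ← hab]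
  chirality_mem_adjoin := mul_mem (Algebra.subset_adjoin ⟨0, rfl⟩) (Algebra.subset_adjoin ⟨1, rfl⟩)
  balance := by simp [Fin.sum_univ_two]; ring

lemma isChiralSystem_mul_pair {a b : R} (ha : a * a = 1) (hb : b * b = 1)
    (hab : a * b = -(b * a)) : IsChiralSystem ![-1, 1] ![a * b, b] (a * b * b) 1 := by
  have ba_eq : b * a = -(a * b) := by rw [hab, neg_neg]
  refine isChiralSystem_pair (.inr rfl) ?_ (by rw [hb, map_one]) ?_
  · rw [mul_assoc, ← mul_assoc b, ba_eq, neg_mul, mul_neg, mul_assoc, hb, ← mul_assoc, ha]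
    simp
  · rw [← mul_assoc, ba_eq, neg_mul, neg_neg]

lemma exists_isChiralSystem_of_anticomm {M : Submonoid R} {a b : R} {α β : ℝ} (ha : a ∈ M)
    (hb : b ∈ M) (hα : α = -1 ∨ α = 1) (hβ : β = -1 ∨ β = 1) (haa : a * a = algebraMap ℝ R α)
    (hbb : b * b = algebraMap ℝ R β) (hab : a * b = -(b * a)) :
    ∃ a' ∈ M, ∃ b' ∈ M, ∃ τ : ℝ, IsChiralSystem ![-1, τ] ![a', b'] (a' * b') τ := by
  rcases hα with rfl | rfl
  · exact ⟨a, ha, b, hb, β, isChiralSystem_pair hβ haa hbb hab⟩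
  rcases hβ with rfl | rfl
  · exact ⟨b, hb, a, ha, 1, isChiralSystem_pair (.inr rfl) hbb haa (by rw [hab, neg_neg])⟩
  · exact ⟨a * b, mul_mem ha hb, b, hb, 1,
      isChiralSystem_mul_pair (by rw [haa, map_one]) (by rw [hbb, map_one]) hab⟩

end ChiralSystems

section Generation

variable {G R : Type*} [AddCommGroup G] [DecidableEq G] [Ring R] [Algebra ℝ R]
  {𝒜 : G → Submodule ℝ R} [GradedAlgebra 𝒜] {ι : Type*} {ε : ι → ℝ} {x : ι → R}

lemma isHomogeneousElem_prod_map (hx : ∀ i, SetLike.IsHomogeneousElem 𝒜 (x i)) (l : List ι) :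
    SetLike.IsHomogeneousElem 𝒜 (l.map x).prod :=
  (SetLike.homogeneousSubmonoid 𝒜).list_prod_mem (List.forall_mem_map.2 fun i _ => hx i)

lemma IsDivisionGrading.exists_unit_notMem (hd : IsDivisionGrading 𝒜) {S : Submodule ℝ R}
    (hS : S ≠ ⊤) : ∃ u : Rˣ, SetLike.IsHomogeneousElem 𝒜 (u : R) ∧ (u : R) ∉ S := by
  contrapose! hS
  refine top_le_iff.1 ((DirectSum.Decomposition.isInternal 𝒜).submodule_iSup_eq_top ▸
    iSup_le fun g a ha => ?_)
  rcases eq_or_ne a 0 with rfl | ha0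
  · exact S.zero_mem
  obtain ⟨u, rfl⟩ := hd g a ha ha0
  exact hS u ⟨g, ha⟩

variable [Nontrivial R] [FiniteDimensional ℝ R]

lemma IsAnticommSystem.exists_commute_mul_prod [Fintype ι] (h : IsAnticommSystem ε x)
    (hι : Even (Fintype.card ι)) (hx : ∀ i, SetLike.IsHomogeneousElem 𝒜 (x i)) (h0 : 𝒜 0 ≤ 1)
    {z : Rˣ} (hz : SetLike.IsHomogeneousElem 𝒜 (z : R)) :
    ∃ l : List ι, ∀ i, Commute (z * (l.map x).prod) (x i) := by
  classical
  have exists_sign (i : ι) : ∃ t : ZMod 2, z * x i = signChar ℝ t • (x i * z) := by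
    obtain ⟨⟨g, hg⟩, ⟨d, hd⟩, ⟨u, hu⟩⟩ := And.intro hz (And.intro (hx i) (h.isUnit i))
    rw [← hu] at hd ⊢
    exact exists_mul_eq_signChar_smul_mul h0 hg hd
  choose t ht using exists_sign
  obtain ⟨g, hg⟩ := commDegree_surjective hι t
  obtain ⟨l, rfl⟩ := wordDegree_surjective g
  refine ⟨l, fun i => ?_⟩
  calc z * (l.map x).prod * x i
      = signChar ℝ (t i) • (z * (signChar ℝ (t i) • ((l.map x).prod * x i))) := by
        rw [mul_smul_comm, smul_smul, ← AddChar.map_add_eq_mul, CharTwo.add_self_eq_zero,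
          AddChar.map_zero_eq_one, one_smul, mul_assoc]
    _ = signChar ℝ (t i) • (z * x i) * (l.map x).prod := by
        rw [← hg, ← h.mul_prod, smul_mul_assoc, mul_assoc]
    _ = x i * (z * (l.map x).prod) := by
        rw [ht, smul_smul, ← AddChar.map_add_eq_mul, CharTwo.add_self_eq_zero,
          AddChar.map_zero_eq_one, one_smul, mul_assoc]

lemma IsAnticommSystem.exists_unit_commute_mul [Fintype ι] (h : IsAnticommSystem ε x)
    (hι : Even (Fintype.card ι)) (hx : ∀ i, SetLike.IsHomogeneousElem 𝒜 (x i)) (h0 : 𝒜 0 ≤ 1)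
    {z : Rˣ} (hz : SetLike.IsHomogeneousElem 𝒜 (z : R)) :
    ∃ p : Rˣ, SetLike.IsHomogeneousElem 𝒜 (z * p : R) ∧
      (p : R) ∈ Algebra.adjoin ℝ (Set.range x) ∧
      (∃ r ≠ (0 : ℝ), (p * p : R) = algebraMap ℝ R r) ∧ ∀ i, Commute (z * p : R) (x i) := by
  classical
  obtain ⟨l, hl⟩ := h.exists_commute_mul_prod hι hx h0 hz
  obtain ⟨p, hp⟩ := h.isUnit_prod l
  obtain ⟨r, hr, hpp⟩ := h.prod_of_wordDegree_eq_zero (l ++ l) (wordDegree_append_self l)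
  rw [List.map_append, List.prod_append] at hpp
  refine ⟨p, ?_, ?_, ⟨r, hr, ?_⟩, ?_⟩ <;> rw [hp]
  · exact hz.mul (isHomogeneousElem_prod_map hx l)
  · exact list_prod_mem (List.forall_mem_map.2 fun i _ =>
      Algebra.subset_adjoin (Set.mem_range_self i))
  · exact hpp
  · exact hl

lemma IsAnticommSystem.exists_commuting_unit_notMem_one [Fintype ι] (h : IsAnticommSystem ε x)
    (hι : Even (Fintype.card ι)) (hx : ∀ i, SetLike.IsHomogeneousElem 𝒜 (x i)) (h0 : 𝒜 0 ≤ 1)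
    (hd : IsDivisionGrading 𝒜) (hadj : Algebra.adjoin ℝ (Set.range x) ≠ ⊤) :
    ∃ y : Rˣ, SetLike.IsHomogeneousElem 𝒜 (y : R) ∧ (y : R) ∉ (1 : Submodule ℝ R) ∧
      ∀ i, Commute (y : R) (x i) := by
  obtain ⟨z, hz, z_notMem⟩ := hd.exists_unit_notMem (mt Algebra.toSubmodule_eq_top.1 hadj)
  obtain ⟨p, hzp, p_mem, ⟨r, hr, hpp⟩, hcomm⟩ := h.exists_unit_commute_mul hι hx h0 hz
  refine ⟨z * p, hzp, fun mem_one => z_notMem ?_, hcomm⟩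
  obtain ⟨c, hc⟩ := Submodule.mem_one.1 mem_one
  have smul_z_eq : r • (z : R) = c • p := by
    rw [Algebra.smul_def, Algebra.smul_def, Algebra.commutes, ← hpp, hc, Units.val_mul, mul_assoc]
  rw [← inv_smul_smul₀ hr (z : R), smul_z_eq]
  exact Subalgebra.smul_mem _ (Subalgebra.smul_mem _ p_mem c) r⁻¹

variable [Algebra.IsCentral ℝ R]

lemma IsDivisionGrading.exists_anticommuting_unit (hd : IsDivisionGrading 𝒜) (h0 : 𝒜 0 ≤ 1)
    {y : Rˣ} (hy : SetLike.IsHomogeneousElem 𝒜 (y : R)) (y_notMem : (y : R) ∉ (1 : Submodule ℝ R)) :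
    ∃ z : Rˣ, SetLike.IsHomogeneousElem 𝒜 (z : R) ∧ (y * z : R) = -(z * y) := by
  obtain ⟨g, hg⟩ := hy
  by_contra! no_anticomm
  refine y_notMem (mem_one_of_forall_homogeneous_commute 𝒜 fun d z hz => ?_)
  rcases eq_or_ne z 0 with rfl | hz0
  · rw [mul_zero, zero_mul]
  obtain ⟨z, rfl⟩ := hd d z hz hz0
  obtain ⟨t, ht⟩ := exists_mul_eq_signChar_smul_mul h0 hg hz
  rcases zmod_two_eq_zero_or_one t with rfl | rfl
  · rw [ht, AddChar.map_zero_eq_one, one_smul]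
  · exact absurd (by rw [ht, signChar_one, neg_one_smul]) (no_anticomm z ⟨d, hz⟩)

lemma IsDivisionGrading.exists_sq_smul_of_homogeneous (hd : IsDivisionGrading 𝒜)
    (h0 : 𝒜 0 ≤ 1) {a : Rˣ} (ha : SetLike.IsHomogeneousElem 𝒜 (a : R)) :
    ∃ t σ : ℝ, (σ = -1 ∨ σ = 1) ∧ (t • a : R) * (t • a : R) = algebraMap ℝ R σ := by
  obtain ⟨g, hg⟩ := ha
  obtain ⟨r, hr⟩ := Submodule.mem_one.1 (hd.mul_self_mem_one h0 hg)
  have r_ne_zero : r ≠ 0 := by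
    rintro rfl
    exact (a * a).ne_zero (by rw [Units.val_mul, ← hr, map_zero])
  exact exists_sq_smul_eq_neg_one_or_one r_ne_zero hr.symm

lemma IsAnticommSystem.exists_isChiralSystem_pair [Fintype ι] (h : IsAnticommSystem ε x)
    (hι : Even (Fintype.card ι)) (hx : ∀ i, SetLike.IsHomogeneousElem 𝒜 (x i)) (h0 : 𝒜 0 ≤ 1)
    (hd : IsDivisionGrading 𝒜) (hadj : Algebra.adjoin ℝ (Set.range x) ≠ ⊤) :
    ∃ (y : Fin 2 → R) (δ : Fin 2 → ℝ) (ζ : R) (τ : ℝ), IsChiralSystem δ y ζ τ ∧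
      (∀ j i, Commute (y j) (x i)) ∧ (∀ j, SetLike.IsHomogeneousElem 𝒜 (y j)) ∧
      SetLike.IsHomogeneousElem 𝒜 ζ := by
  let M : Submonoid R :=
    SetLike.homogeneousSubmonoid 𝒜 ⊓ Submonoid.centralizer (Set.range x)
  have smul_mem (t : ℝ) {a : R} (ha : SetLike.IsHomogeneousElem 𝒜 a)
      (hax : ∀ i, Commute a (x i)) : t • a ∈ M :=
    ⟨ha.imp fun g hg => (𝒜 g).smul_mem t hg, Submonoid.mem_centralizer_iff.2
      (Set.forall_mem_range.2 fun i => ((hax i).smul_left t).symm)⟩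
  obtain ⟨y, hy, y_notMem, hyx⟩ := h.exists_commuting_unit_notMem_one hι hx h0 hd hadj
  obtain ⟨z, hz, hyz⟩ := hd.exists_anticommuting_unit h0 hy y_notMem
  obtain ⟨p, hzp, p_mem, -, hcomm⟩ := h.exists_unit_commute_mul hι hx h0 hz
  have anticomm : (y * (z * p) : R) = -(z * p * y) := by
    rw [← mul_assoc, hyz, neg_mul, mul_assoc, (commute_of_mem_adjoin_range hyx p_mem).eq, mul_assoc]
  obtain ⟨t, α, hα, haa⟩ := hd.exists_sq_smul_of_homogeneous h0 hy
  obtain ⟨t', β, hβ, hbb⟩ := hd.exists_sq_smul_of_homogeneous h0 (a := z * p) hzp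
  obtain ⟨a, ha, b, hb, τ, hab⟩ := exists_isChiralSystem_of_anticomm (smul_mem t hy hyx)
    (smul_mem t' hzp hcomm) hα hβ haa hbb (by
      rw [smul_mul_smul_comm, smul_mul_smul_comm, anticomm, smul_neg, mul_comm])
  have commute_of_mem {c : R} (hc : c ∈ M) (i : ι) : Commute c (x i) :=
    (Submonoid.mem_centralizer_iff.1 hc.2 _ (Set.mem_range_self i)).symm
  exact ⟨_, _, _, τ, hab, Fin.forall_fin_two.2 ⟨commute_of_mem ha, commute_of_mem hb⟩,
    Fin.forall_fin_two.2 ⟨ha.1, hb.1⟩, (mul_mem ha hb).1⟩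

end Generation

section ChiralGeneration

lemma isChiralSystem_of_isEmpty {ι R : Type*} [Fintype ι] [IsEmpty ι] [Ring R] [Algebra ℝ R] :
    IsChiralSystem (isEmptyElim : ι → ℝ) (isEmptyElim : ι → R) 1 1 where
  sq := isEmptyElim
  anticomm := isEmptyElim
  ne_zero := isEmptyElim
  sign := isEmptyElim
  chirality_sign := .inr rfl
  chirality_sq := by simp
  chirality_anticomm := isEmptyElim
  chirality_mem_adjoin := one_mem _
  balance := by simp

/-- A chiral system in a graded algebra whose members and chirality element are homogeneous. -/
structure IsHomogeneousChiralSystem {G ι R : Type*} [Fintype ι] [Ring R] [Algebra ℝ R]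
    (𝒜 : G → Submodule ℝ R) (ε : ι → ℝ) (x : ι → R) (ω : R) (s : ℝ) : Prop extends
    IsChiralSystem ε x ω s where
  homogeneous (i : ι) : SetLike.IsHomogeneousElem 𝒜 (x i)
  chirality_homogeneous : SetLike.IsHomogeneousElem 𝒜 ω

lemma IsHomogeneousChiralSystem.sum_elim {G ι κ R : Type*} [AddMonoid G] [Fintype ι] [Fintype κ]
    [Ring R] [Algebra ℝ R] {𝒜 : G → Submodule ℝ R} [SetLike.GradedMonoid 𝒜] {ε : ι → ℝ}
    {x : ι → R} {ω : R} {s : ℝ} {δ : κ → ℝ} {y : κ → R} {ζ : R} {τ : ℝ}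
    (h : IsHomogeneousChiralSystem 𝒜 ε x ω s) (h' : IsHomogeneousChiralSystem 𝒜 δ y ζ τ)
    (hyx : ∀ j i, Commute (y j) (x i)) : IsHomogeneousChiralSystem 𝒜 (Sum.elim ε (s • δ))
      (Sum.elim x fun j => ω * y j) (ω * ζ) (s * τ) where
  toIsChiralSystem := h.toIsChiralSystem.sum_elim h'.toIsChiralSystem hyx
  homogeneous :=
    Sum.forall.2 ⟨h.homogeneous, fun j => h.chirality_homogeneous.mul (h'.homogeneous j)⟩
  chirality_homogeneous := h.chirality_homogeneous.mul h'.chirality_homogeneous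

variable {G R : Type*} [AddCommGroup G] [DecidableEq G] [Ring R] [Algebra ℝ R]
  [Nontrivial R] [FiniteDimensional ℝ R] [Algebra.IsCentral ℝ R]
  {𝒜 : G → Submodule ℝ R} [GradedAlgebra 𝒜]

lemma IsHomogeneousChiralSystem.exists_sum {ι : Type*} [Fintype ι] {ε : ι → ℝ} {x : ι → R}
    {ω : R} {s : ℝ} (h : IsHomogeneousChiralSystem 𝒜 ε x ω s) (h0 : 𝒜 0 ≤ 1)
    (hd : IsDivisionGrading 𝒜) (hadj : Algebra.adjoin ℝ (Set.range x) ≠ ⊤) :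
    ∃ (ε' : ι ⊕ Fin 2 → ℝ) (x' : ι ⊕ Fin 2 → R) (ω' : R) (s' : ℝ),
      IsHomogeneousChiralSystem 𝒜 ε' x' ω' s' := by
  obtain ⟨y, δ, ζ, τ, hy, hyx, y_hom, ζ_hom⟩ :=
    h.exists_isChiralSystem_pair h.even_card h.homogeneous h0 hd hadj
  exact ⟨_, _, _, _, h.sum_elim ⟨hy, y_hom, ζ_hom⟩ hyx⟩

theorem IsDivisionGrading.exists_generating_isHomogeneousChiralSystem
    (hd : IsDivisionGrading 𝒜) (h0 : 𝒜 0 ≤ 1) :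
    ∃ (ι : Type) (_ : Fintype ι) (ε : ι → ℝ) (x : ι → R) (ω : R) (s : ℝ),
      IsHomogeneousChiralSystem 𝒜 ε x ω s ∧ Algebra.adjoin ℝ (Set.range x) = ⊤ := by
  classical
  by_contra! not_generating
  have exists_of_card (k : ℕ) : ∃ (ι : Type) (_ : Fintype ι) (ε : ι → ℝ) (x : ι → R) (ω : R)
      (s : ℝ), IsHomogeneousChiralSystem 𝒜 ε x ω s ∧ Fintype.card ι = 2 * k := by
    induction k with
    | zero =>
      exact ⟨Empty, inferInstance, _, _, 1, 1,
        ⟨isChiralSystem_of_isEmpty, isEmptyElim, SetLike.isHomogeneousElem_one 𝒜⟩, rfl⟩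
    | succ k ih =>
      obtain ⟨ι, _, ε, x, ω, s, h, hι⟩ := ih
      obtain ⟨ε', x', ω', s', h'⟩ :=
        h.exists_sum h0 hd (not_generating ι _ ε x ω s h)
      exact ⟨ι ⊕ Fin 2, inferInstance, ε', x', ω', s', h', by simp [hι, mul_add]⟩
  obtain ⟨ι, _, ε, x, ω, s, h, hι⟩ := exists_of_card (Module.finrank ℝ R)
  have pow_le := h.pow_card_le_finrank h.even_card
  have lt_pow := (2 * Module.finrank ℝ R).lt_two_pow_self
  rw [hι] at pow_le
  lia

end ChiralGeneration

/-! ### From chiral systems to presentations -/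

section Presentations

variable {ι G R : Type*} [Fintype ι] [Ring R] [Algebra ℝ R] {ε : ι → ℝ} {x : ι → R} {ω : R} {s : ℝ}
  {n p m : ℕ}

lemma IsChiralSystem.exists_isAnticommSystem_firstNegative (h : IsChiralSystem ε x ω s)
    (hι : Fintype.card ι = n) (hpm : p + m = n) (hs : (m : ℝ) - p = s - 1) :
    ∃ e : Fin n ≃ ι, IsAnticommSystem (firstNegative n p) (x ∘ e) := by
  obtain ⟨e, he⟩ := exists_equiv_of_sum_signs_eq h.sign (firstNegative_eq_neg_one_or_one n p)
    (by rw [Fintype.card_fin, hι]) (by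
      rw [sum_firstNegative (hpm ▸ p.le_add_right m), h.balance, ← hs, ← hpm]
      push_cast
      ring)
  exact ⟨e, funext he ▸ h.comp_injective e.injective⟩

variable [AddCommGroup G] [Nontrivial R] {𝒜 : G → Submodule ℝ R}

lemma IsHomogeneousChiralSystem.hasAnticommPresentation [Module (ZMod 2) G]
    [Module.Finite (ZMod 2) G] [SetLike.GradedMonoid 𝒜]
    (h : IsHomogeneousChiralSystem 𝒜 ε x ω s) (hι : Fintype.card ι = n) (hpm : p + m = n)
    (hs : (m : ℝ) - p = s - 1) (hR : Module.finrank ℝ R = 2 ^ n)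
    (hG : Module.finrank (ZMod 2) G = n) (h𝒜 : ∀ g, (𝒜 g).IsPrincipal) :
    HasAnticommPresentation (firstNegative n p) 𝒜 := by
  obtain ⟨e, he⟩ := h.exists_isAnticommSystem_firstNegative hι hpm hs
  choose d hd using h.homogeneous
  exact he.hasAnticommPresentation_of_finrank (hι ▸ h.even_card) hR hG h𝒜 fun i => hd (e i)

lemma finrank_eq_of_finrank_component_eq_one [DecidableEq G] [FiniteDimensional ℝ R]
    [GradedAlgebra 𝒜] [Module (ZMod 2) G] [Finite G] (h𝒜 : ∀ g, Module.finrank ℝ (𝒜 g) = 1)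
    (hR : Module.finrank ℝ R = 2 ^ n) : Module.finrank (ZMod 2) G = n := by
  have := Fintype.ofFinite G
  have card_eq : Nat.card G = 2 ^ n := by
    rw [← hR, (DirectSum.decomposeLinearEquiv 𝒜).finrank_eq, Module.finrank_directSum]
    simp [h𝒜]
  rw [Module.natCard_eq_pow_finrank (K := ZMod 2), Nat.card_zmod] at card_eq
  exact Nat.pow_right_injective le_rfl card_eq

lemma IsDivisionGrading.exists_hasAnticommPresentation [DecidableEq G] [FiniteDimensional ℝ R]
    [Algebra.IsCentral ℝ R] [GradedAlgebra 𝒜] (hd : IsDivisionGrading 𝒜) (h0 : 𝒜 0 ≤ 1)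
    (hu : ∀ g, ∃ u : Rˣ, (u : R) ∈ 𝒜 g) :
    ∃ k, HasAnticommPresentation (firstNegative (2 * k) k) 𝒜 ∨
      1 ≤ k ∧ HasAnticommPresentation (firstNegative (2 * k) (k + 1)) 𝒜 := by
  have h𝒜 (g : G) : Module.finrank ℝ (𝒜 g) = 1 :=
    (hu g).elim fun _ hu => finrank_eq_one_of_unit_mem h0 hu
  have two_nsmul (g : G) : 2 • g = 0 := by
    obtain ⟨u, hu⟩ := hu g
    rw [two_nsmul, hd.add_self_eq_zero h0 hu]
  have := finite_of_forall_exists_unit_mem hu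
  let _ : Module (ZMod 2) G := AddCommGroup.zmodModule two_nsmul
  obtain ⟨ι, _, ε, x, ω, s, h, hx⟩ := hd.exists_generating_isHomogeneousChiralSystem h0
  classical
  have hR := h.finrank_eq h.even_card hx
  have hG := finrank_eq_of_finrank_component_eq_one h𝒜 hR
  have principal (g : G) : (𝒜 g).IsPrincipal :=
    (Submodule.finrank_le_one_iff_isPrincipal _).1 (h𝒜 g).le
  obtain ⟨k, hk⟩ := even_iff_two_dvd.1 h.even_card
  rw [hk] at hR hG
  refine ⟨k, ?_⟩
  rcases h.chirality_sign with rfl | rfl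
  · obtain _ | k := k
    · have := Fintype.card_eq_zero_iff.1 hk
      have balance := h.balance
      norm_num at balance
    · refine .inr ⟨k.succ_pos, h.hasAnticommPresentation hk (m := k) (by lia) ?_ hR hG principal⟩
      push_cast
      ring
  · exact .inl (h.hasAnticommPresentation hk (two_mul k).symm (by simp) hR hG principal)

end Presentations

/-! ### Clifford algebras -/

section Cliff

variable (p m : ℕ)

lemma standardForm_single (i : Fin (p + m)) :
    (-standardForm p m) (Pi.single i 1) = firstNegative (p + m) p i := by
  simp only [standardForm, neg_apply, QuadraticMap.weightedSumSquares_apply, firstNegative]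
  rw [Finset.sum_eq_single i (fun j _ hj => by simp [Pi.single_eq_of_ne hj]) (by simp)]
  split_ifs <;> simp

lemma isOrtho_standardForm_single {i j : Fin (p + m)} (hij : i ≠ j) :
    (-standardForm p m).IsOrtho (Pi.single i 1) (Pi.single j 1) := by
  rw [QuadraticMap.isOrtho_def]
  simp only [standardForm, neg_apply, QuadraticMap.weightedSumSquares_apply, ← neg_add,
    ← Finset.sum_add_distrib]
  refine congrArg _ (Finset.sum_congr rfl fun l _ => ?_)
  obtain rfl | hl := eq_or_ne l i
  · simp [Pi.single_eq_of_ne hij]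
  · simp [Pi.single_eq_of_ne hl]

lemma isAnticommSystem_cliffGen :
    IsAnticommSystem (firstNegative (p + m) p) (cliffGen p m) where
  sq i := by rw [cliffGen, CliffordAlgebra.ι_sq_scalar, standardForm_single]
  anticomm _ _ hij := CliffordAlgebra.ι_mul_ι_comm_of_isOrtho (isOrtho_standardForm_single p m hij)
  ne_zero i := ne_zero_of_eq_neg_one_or_one (firstNegative_eq_neg_one_or_one _ _ i)

lemma adjoin_cliffGen : Algebra.adjoin ℝ (Set.range (cliffGen p m)) = ⊤ := by
  rw [eq_top_iff, ← CliffordAlgebra.adjoin_range_ι, Algebra.adjoin_le_iff]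
  rintro _ ⟨v, rfl⟩
  rw [← (Pi.basisFun ℝ _).sum_repr v, map_sum]
  refine sum_mem fun i _ => ?_
  rw [map_smul, Pi.basisFun_apply]
  exact Subalgebra.smul_mem _ (Algebra.subset_adjoin (Set.mem_range_self i)) _

lemma isDivisionGrading_cliffGrading : IsDivisionGrading (cliffGrading p m) :=
  (isAnticommSystem_cliffGen p m).isDivisionGrading

lemma finrank_cliffGrading (g : Fin (p + m) → ZMod 2) :
    Module.finrank ℝ (cliffGrading p m g) = 1 :=
  (isAnticommSystem_cliffGen p m).finrank_standardGrading g

variable {p m} {n : ℕ}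

lemma nonempty_gradedAlgebra_cliffGrading (h : Even (p + m)) :
    Nonempty (GradedAlgebra (cliffGrading p m)) :=
  (isAnticommSystem_cliffGen p m).nonempty_gradedAlgebra (by simpa using h) (adjoin_cliffGen p m)

lemma hasAnticommPresentation_cliffGrading (hpm : p + m = n) (hn : Even n) :
    HasAnticommPresentation (firstNegative n p) (cliffGrading p m) := by
  subst hpm
  exact (isAnticommSystem_cliffGen p m).hasAnticommPresentation_monomialGrading hn
    (adjoin_cliffGen p m) ⟨inferInstance, Pi.basisFun _ _, Pi.basisFun_apply _ _⟩

lemma IsChiralSystem.nonempty_cliff_algEquiv {ι R : Type*} [Fintype ι] [Ring R] [Algebra ℝ R]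
    [Nontrivial R] {ε : ι → ℝ} {x : ι → R} {ω : R} {s : ℝ} (h : IsChiralSystem ε x ω s)
    (hι : Fintype.card ι = p + m) (hs : (m : ℝ) - p = s - 1)
    (hR : Module.finrank ℝ R = 2 ^ (p + m)) : Nonempty (Cliff p m ≃ₐ[ℝ] R) := by
  obtain ⟨e, he⟩ := h.exists_isAnticommSystem_firstNegative hι rfl hs
  have p_add_m_even : Even (p + m) := hι ▸ h.even_card
  have adjoin_eq_top := he.adjoin_eq_top (by simpa using p_add_m_even) (by simpa using hR)
  obtain ⟨φ, -⟩ := he.exists_algEquiv_anticommAlgebra p_add_m_even adjoin_eq_top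
  obtain ⟨ψ, -⟩ := (isAnticommSystem_cliffGen p m).exists_algEquiv_anticommAlgebra p_add_m_even
    (adjoin_cliffGen p m)
  exact ⟨ψ.trans φ.symm⟩

end Cliff

/-! ### Matrix models -/

section Matrices

namespace IsChiralSystem

variable {ι κ R S : Type*} [Fintype ι] [Fintype κ] [Ring R] [Algebra ℝ R] [Ring S] [Algebra ℝ S]
  {ε : ι → ℝ} {x : ι → R} {ω : R} {s : ℝ} {δ : κ → ℝ} {y : κ → S} {ζ : S} {τ : ℝ}

lemma map (h : IsChiralSystem ε x ω s) (φ : R →ₐ[ℝ] S) : IsChiralSystem ε (φ ∘ x) (φ ω) s where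
  toIsAnticommSystem := h.toIsAnticommSystem.map φ
  sign := h.sign
  chirality_sign := h.chirality_sign
  chirality_sq := by rw [← map_mul, h.chirality_sq, AlgHom.commutes]
  chirality_anticomm i := by
    rw [Function.comp_apply, ← map_mul, h.chirality_anticomm, map_neg, map_mul]
  chirality_mem_adjoin := by
    rw [Set.range_comp, ← AlgHom.map_adjoin]
    exact ⟨ω, h.chirality_mem_adjoin, rfl⟩
  balance := h.balance

lemma tensorProduct (h : IsChiralSystem ε x ω s) (h' : IsChiralSystem δ y ζ τ) :
    IsChiralSystem (Sum.elim ε (s • δ)) (Sum.elim (fun i => x i ⊗ₜ[ℝ] (1 : S)) fun j => ω ⊗ₜ y j)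
      (ω ⊗ₜ ζ) (s * τ) := by
  have includeLeft := h.map (Algebra.TensorProduct.includeLeft : R →ₐ[ℝ] R ⊗[ℝ] S)
  have includeRight := h'.map (Algebra.TensorProduct.includeRight : S →ₐ[ℝ] R ⊗[ℝ] S)
  simpa [Function.comp_def] using
    includeLeft.sum_elim includeRight fun j i => by simp [Commute, SemiconjBy]

end IsChiralSystem

variable (k : ℕ)

lemma sylvesterA_mul_self : sylvesterA * sylvesterA = 1 := by
  simp [sylvesterA, Matrix.one_fin_two]

lemma sylvesterB_mul_self : sylvesterB * sylvesterB = 1 := by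
  simp [sylvesterB, Matrix.one_fin_two]

lemma sylvesterA_mul_sylvesterB : sylvesterA * sylvesterB = -(sylvesterB * sylvesterA) := by
  simp [sylvesterA, sylvesterB]

lemma isChiralSystem_sylvester :
    IsChiralSystem ![-1, 1] ![sylvesterA * sylvesterB, sylvesterB]
      (sylvesterA * sylvesterB * sylvesterB) 1 :=
  isChiralSystem_mul_pair sylvesterA_mul_self sylvesterB_mul_self sylvesterA_mul_sylvesterB

lemma isChiralSystem_quaternion :
    IsChiralSystem ![-1, -1] ![(⟨0, 1, 0, 0⟩ : ℍ[ℝ]), ⟨0, 0, 1, 0⟩]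
      (⟨0, 1, 0, 0⟩ * ⟨0, 0, 1, 0⟩) (-1) :=
  isChiralSystem_pair (.inl rfl) (by ext <;> simp) (by ext <;> simp) (by ext <;> simp)

lemma exists_isChiralSystem_matrix :
    ∃ (ι : Type) (_ : Fintype ι) (ε : ι → ℝ) (x : ι → Matrix (Fin (2 ^ k)) (Fin (2 ^ k)) ℝ)
      (ω : Matrix (Fin (2 ^ k)) (Fin (2 ^ k)) ℝ),
      IsChiralSystem ε x ω 1 ∧ Fintype.card ι = 2 * k := by
  induction k with
  | zero => exact ⟨Empty, inferInstance, _, _, 1, isChiralSystem_of_isEmpty, rfl⟩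
  | succ k ih =>
    obtain ⟨ι, _, ε, x, ω, h, hι⟩ := ih
    have tensor := (h.tensorProduct isChiralSystem_sylvester).map
      ((Matrix.kroneckerAlgEquiv (Fin (2 ^ k)) (Fin 2) ℝ).trans
        (Matrix.reindexAlgEquiv ℝ ℝ finProdFinEquiv)).toAlgHom
    rw [mul_one] at tensor
    exact ⟨ι ⊕ Fin 2, inferInstance, _, _, _, tensor, by simp [hι, mul_add]⟩

lemma exists_isChiralSystem_matrix_quaternion :
    ∃ (ι : Type) (_ : Fintype ι) (ε : ι → ℝ) (x : ι → Matrix (Fin (2 ^ k)) (Fin (2 ^ k)) ℍ[ℝ])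
      (ω : Matrix (Fin (2 ^ k)) (Fin (2 ^ k)) ℍ[ℝ]),
      IsChiralSystem ε x ω (-1) ∧ Fintype.card ι = 2 * (k + 1) := by
  obtain ⟨ι, _, ε, x, ω, h, hι⟩ := exists_isChiralSystem_matrix k
  have tensor := (h.tensorProduct isChiralSystem_quaternion).map
    ((Algebra.TensorProduct.comm ℝ _ _).trans
      (matrixEquivTensor (Fin (2 ^ k)) ℝ ℍ[ℝ]).symm).toAlgHom
  rw [one_mul] at tensor
  exact ⟨ι ⊕ Fin 2, inferInstance, _, _, _, tensor, by simp [hι, mul_add]⟩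

lemma nonempty_cliff_algEquiv_matrix :
    Nonempty (Cliff k k ≃ₐ[ℝ] Matrix (Fin (2 ^ k)) (Fin (2 ^ k)) ℝ) := by
  obtain ⟨ι, _, ε, x, ω, h, hι⟩ := exists_isChiralSystem_matrix k
  refine h.nonempty_cliff_algEquiv (hι.trans (two_mul k)) (by simp) ?_
  rw [Module.finrank_matrix, Module.finrank_self, Fintype.card_fin, mul_one, pow_add]

lemma nonempty_cliff_algEquiv_matrix_quaternion :
    Nonempty (Cliff (k + 2) k ≃ₐ[ℝ] Matrix (Fin (2 ^ k)) (Fin (2 ^ k)) ℍ[ℝ]) := by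
  obtain ⟨ι, _, ε, x, ω, h, hι⟩ := exists_isChiralSystem_matrix_quaternion k
  refine h.nonempty_cliff_algEquiv (hι.trans (by ring)) (by push_cast; ring) ?_
  rw [Module.finrank_matrix, Quaternion.finrank_eq_four, Fintype.card_fin]
  ring

end Matrices

/-! ### Graded tensor products -/

section SpanSingleton

variable {R : Type*} [Ring R] [Algebra ℝ R] {a b : R} {α β : ℝ}

lemma IsAnticommSystem.span_pow_mul_pow (h : IsAnticommSystem ![α, β] ![a, b])
    (g : ZMod 2 × ZMod 2) :
    Submodule.span ℝ {a ^ g.1.val * b ^ g.2.val} = standardGrading ![a, b] ![g.1, g.2] := by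
  have degree : wordDegree (List.replicate g.1.val (0 : Fin 2) ++ List.replicate g.2.val 1) =
      ![g.1, g.2] := by
    funext i
    fin_cases i <;> simp [wordDegree_apply, List.count_replicate]
  rw [← degree, h.standardGrading_wordDegree]
  simp

lemma IsAnticommSystem.gradedMonoid_span_pow_mul_pow (h : IsAnticommSystem ![α, β] ![a, b]) :
    SetLike.GradedMonoid
      fun g : ZMod 2 × ZMod 2 => Submodule.span ℝ {a ^ g.1.val * b ^ g.2.val} where
  one_mem := Submodule.mem_span_singleton.2 ⟨1, by simp⟩
  mul_mem g g' y z hy hz := by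
    rw [h.span_pow_mul_pow] at hy hz ⊢
    simpa using SetLike.GradedMul.mul_mem hy hz

lemma isHomogeneousElem_span_pow_mul_pow_left (a b : R) : SetLike.IsHomogeneousElem
    (fun g : ZMod 2 × ZMod 2 => Submodule.span ℝ {a ^ g.1.val * b ^ g.2.val}) a :=
  ⟨(1, 0), Submodule.mem_span_singleton.2 ⟨1, by simp [ZMod.val_one]⟩⟩

lemma isHomogeneousElem_span_pow_mul_pow_right (a b : R) : SetLike.IsHomogeneousElem
    (fun g : ZMod 2 × ZMod 2 => Submodule.span ℝ {a ^ g.1.val * b ^ g.2.val}) b :=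
  ⟨(0, 1), Submodule.mem_span_singleton.2 ⟨1, by simp [ZMod.val_one]⟩⟩

end SpanSingleton

section TensorGrading

variable {G H R S : Type*} [Ring R] [Algebra ℝ R] [Ring S] [Algebra ℝ S]
  {𝒜 : G → Submodule ℝ R} {ℬ : H → Submodule ℝ S}

lemma tmul_mem_tensorGrading {g : G} {h : H} {a : R} {b : S} (ha : a ∈ 𝒜 g) (hb : b ∈ ℬ h) :
    a ⊗ₜ[ℝ] b ∈ tensorGrading 𝒜 ℬ (g, h) :=
  Submodule.subset_span ⟨a, ha, b, hb, rfl⟩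

lemma isPrincipal_tensorGrading (h𝒜 : ∀ g, (𝒜 g).IsPrincipal) (hℬ : ∀ h, (ℬ h).IsPrincipal)
    (g : G × H) : (tensorGrading 𝒜 ℬ g).IsPrincipal := by
  obtain ⟨a, ha⟩ := h𝒜 g.1
  obtain ⟨b, hb⟩ := hℬ g.2
  refine ⟨a ⊗ₜ b, le_antisymm (Submodule.span_le.2 ?_) ((Submodule.span_singleton_le_iff_mem _ _).2
    (tmul_mem_tensorGrading (ha ▸ Submodule.mem_span_singleton_self a)
      (hb ▸ Submodule.mem_span_singleton_self b)))⟩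
  rintro _ ⟨x, hx, y, hy, rfl⟩
  rw [ha] at hx
  rw [hb] at hy
  obtain ⟨c, rfl⟩ := Submodule.mem_span_singleton.1 hx
  obtain ⟨d, rfl⟩ := Submodule.mem_span_singleton.1 hy
  rw [TensorProduct.smul_tmul_smul]
  exact Submodule.smul_mem _ _ (Submodule.mem_span_singleton_self _)

variable [AddMonoid H] [SetLike.GradedMonoid ℬ]

lemma IsHomogeneousChiralSystem.tensorProduct {ι κ : Type*} [Fintype ι] [Fintype κ]
    {ε : ι → ℝ} {x : ι → R} {ω : R} {s : ℝ} {δ : κ → ℝ} {y : κ → S} {ζ : S} {τ : ℝ}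
    (h : IsHomogeneousChiralSystem 𝒜 ε x ω s) (h' : IsHomogeneousChiralSystem ℬ δ y ζ τ) :
    IsHomogeneousChiralSystem (tensorGrading 𝒜 ℬ) (Sum.elim ε (s • δ))
      (Sum.elim (fun i => x i ⊗ₜ[ℝ] (1 : S)) fun j => ω ⊗ₜ y j) (ω ⊗ₜ ζ) (s * τ) where
  toIsChiralSystem := h.toIsChiralSystem.tensorProduct h'.toIsChiralSystem
  homogeneous
    | .inl i => (h.homogeneous i).elim fun _ hx =>
      ⟨_, tmul_mem_tensorGrading hx SetLike.GradedOne.one_mem⟩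
    | .inr j => h.chirality_homogeneous.elim fun _ hω => (h'.homogeneous j).elim fun _ hy =>
      ⟨_, tmul_mem_tensorGrading hω hy⟩
  chirality_homogeneous := h.chirality_homogeneous.elim fun _ hω =>
    h'.chirality_homogeneous.elim fun _ hζ => ⟨_, tmul_mem_tensorGrading hω hζ⟩

instance tensorGrading.gradedMonoid [AddMonoid G] [SetLike.GradedMonoid 𝒜] :
    SetLike.GradedMonoid (tensorGrading 𝒜 ℬ) where
  one_mem := tmul_mem_tensorGrading (SetLike.GradedOne.one_mem (A := 𝒜))
    (SetLike.GradedOne.one_mem (A := ℬ))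
  mul_mem g h _ _ hx hy := by
    refine mul_mem_of_mem_span ?_ hx hy
    rintro _ ⟨a, ha, b, hb, rfl⟩ _ ⟨c, hc, d, hd, rfl⟩
    rw [Algebra.TensorProduct.tmul_mul_tmul]
    exact tmul_mem_tensorGrading (SetLike.GradedMul.mul_mem ha hc) (SetLike.GradedMul.mul_mem hb hd)

end TensorGrading

section Models

instance m2Grading.gradedMonoid : SetLike.GradedMonoid m2Grading :=
  (isAnticommSystem_pair one_ne_zero one_ne_zero (by simp [sylvesterA_mul_self])
    (by simp [sylvesterB_mul_self]) sylvesterA_mul_sylvesterB).gradedMonoid_span_pow_mul_pow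

instance quaternionGrading.gradedMonoid : SetLike.GradedMonoid quaternionGrading :=
  isChiralSystem_quaternion.gradedMonoid_span_pow_mul_pow

lemma isHomogeneousChiralSystem_sylvester :
    IsHomogeneousChiralSystem m2Grading ![-1, 1] ![sylvesterA * sylvesterB, sylvesterB]
      (sylvesterA * sylvesterB * sylvesterB) 1 := by
  have A_homogeneous : SetLike.IsHomogeneousElem m2Grading sylvesterA :=
    isHomogeneousElem_span_pow_mul_pow_left _ _
  have B_homogeneous : SetLike.IsHomogeneousElem m2Grading sylvesterB :=
    isHomogeneousElem_span_pow_mul_pow_right _ _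
  exact ⟨isChiralSystem_sylvester,
    Fin.forall_fin_two.2 ⟨A_homogeneous.mul B_homogeneous, B_homogeneous⟩,
    (A_homogeneous.mul B_homogeneous).mul B_homogeneous⟩

lemma isHomogeneousChiralSystem_quaternion :
    IsHomogeneousChiralSystem quaternionGrading ![-1, -1] ![(⟨0, 1, 0, 0⟩ : ℍ[ℝ]), ⟨0, 0, 1, 0⟩]
      (⟨0, 1, 0, 0⟩ * ⟨0, 0, 1, 0⟩) (-1) := by
  have i_homogeneous : SetLike.IsHomogeneousElem quaternionGrading ⟨0, 1, 0, 0⟩ :=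
    isHomogeneousElem_span_pow_mul_pow_left _ _
  have j_homogeneous : SetLike.IsHomogeneousElem quaternionGrading ⟨0, 0, 1, 0⟩ :=
    isHomogeneousElem_span_pow_mul_pow_right _ _
  exact ⟨isChiralSystem_quaternion, Fin.forall_fin_two.2 ⟨i_homogeneous, j_homogeneous⟩,
    i_homogeneous.mul j_homogeneous⟩

end Models

section M2Power

variable {k : ℕ}

lemma tprod_mem_m2PowerGrading {g : Fin k → ZMod 2 × ZMod 2}
    {a : Fin k → Matrix (Fin 2) (Fin 2) ℝ} (ha : ∀ i, a i ∈ m2Grading (g i)) :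
    PiTensorProduct.tprod ℝ a ∈ m2PowerGrading k g :=
  Submodule.subset_span ⟨a, ha, rfl⟩

lemma isPrincipal_m2PowerGrading (g : Fin k → ZMod 2 × ZMod 2) :
    (m2PowerGrading k g).IsPrincipal := by
  refine ⟨PiTensorProduct.tprod ℝ fun i => sylvesterA ^ (g i).1.val * sylvesterB ^ (g i).2.val,
    le_antisymm (Submodule.span_le.2 ?_) ((Submodule.span_singleton_le_iff_mem _ _).2
      (tprod_mem_m2PowerGrading fun i => Submodule.mem_span_singleton_self _))⟩
  rintro _ ⟨a, ha, rfl⟩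
  choose c hc using fun i => Submodule.mem_span_singleton.1 (ha i)
  rw [← funext hc, MultilinearMap.map_smul_univ]
  exact Submodule.smul_mem _ _ (Submodule.mem_span_singleton_self _)

instance m2PowerGrading.gradedMonoid : SetLike.GradedMonoid (m2PowerGrading k) where
  one_mem := tprod_mem_m2PowerGrading fun _ => SetLike.GradedOne.one_mem (A := m2Grading)
  mul_mem g h _ _ hx hy := by
    refine mul_mem_of_mem_span ?_ hx hy
    rintro _ ⟨a, ha, rfl⟩ _ ⟨b, hb, rfl⟩
    rw [PiTensorProduct.tprod_mul_tprod]
    exact tprod_mem_m2PowerGrading fun i =>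
      SetLike.GradedMul.mul_mem (A := m2Grading) (ha i) (hb i)

lemma finrank_m2Power : Module.finrank ℝ (M2Power k) = 2 ^ (2 * k) := by
  rw [Module.finrank_eq_nat_card_basis
    (Basis.piTensorProduct fun _ : Fin k => Matrix.stdBasis ℝ (Fin 2) (Fin 2))]
  simp [pow_mul]

lemma isHomogeneousElem_singleAlgHom (l : Fin k) {a : Matrix (Fin 2) (Fin 2) ℝ}
    (ha : SetLike.IsHomogeneousElem m2Grading a) :
    SetLike.IsHomogeneousElem (m2PowerGrading k)
      (PiTensorProduct.singleAlgHom (R := ℝ) (A := fun _ => Matrix (Fin 2) (Fin 2) ℝ) l a) := by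
  obtain ⟨g, ha⟩ := ha
  refine ⟨Pi.single l g, tprod_mem_m2PowerGrading fun i => ?_⟩
  obtain rfl | hi := eq_or_ne i l
  · simpa using ha
  · simpa [hi] using SetLike.GradedOne.one_mem (A := m2Grading)

lemma commute_singleAlgHom {l l' : Fin k} (hl : l ≠ l') (a b : Matrix (Fin 2) (Fin 2) ℝ) :
    Commute
      (PiTensorProduct.singleAlgHom (R := ℝ) (A := fun _ => Matrix (Fin 2) (Fin 2) ℝ) l a)
      (PiTensorProduct.singleAlgHom (R := ℝ) (A := fun _ => Matrix (Fin 2) (Fin 2) ℝ) l' b) :=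
  Commute.tprod (Pi.mulSingle_commute (f := fun _ => Matrix (Fin 2) (Fin 2) ℝ) hl a b)

end M2Power

section CommutingFamilies

variable {G R L : Type*} {κ : Type} [AddMonoid G] [Ring R] [Algebra ℝ R] {𝒜 : G → Submodule ℝ R}
  [SetLike.GradedMonoid 𝒜] [Fintype κ] {δ : L → κ → ℝ} {y : L → κ → R} {ζ : L → R} {τ : L → ℝ}

lemma exists_isHomogeneousChiralSystem_prod
    (h : ∀ l, IsHomogeneousChiralSystem 𝒜 (δ l) (y l) (ζ l) (τ l))
    (hy : ∀ l l', l ≠ l' → ∀ i j, Commute (y l i) (y l' j)) (t : Finset L) :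
    ∃ (ι : Type) (_ : Fintype ι) (ε : ι → ℝ) (x : ι → R) (ω : R),
      IsHomogeneousChiralSystem 𝒜 ε x ω (∏ l ∈ t, τ l) ∧
      Fintype.card ι = t.card * Fintype.card κ ∧
      ∀ a, (∀ l ∈ t, ∀ j, Commute a (y l j)) → ∀ i, Commute a (x i) := by
  classical
  induction t using Finset.induction_on with
  | empty =>
    exact ⟨Empty, inferInstance, _, _, 1,
      ⟨isChiralSystem_of_isEmpty, isEmptyElim, SetLike.isHomogeneousElem_one 𝒜⟩,
      by simp, fun _ _ => isEmptyElim⟩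
  | insert l t hl ih =>
    obtain ⟨ι, _, ε, x, ω, hx, hι, commute_x⟩ := ih
    have commute_yx (j : κ) : ∀ i, Commute (y l j) (x i) :=
      commute_x _ fun l' hl' => hy l l' (by rintro rfl; exact hl hl') j
    refine ⟨ι ⊕ κ, inferInstance, _, _, _,
      by simpa only [Finset.prod_insert hl, mul_comm] using hx.sum_elim (h l) commute_yx,
      by simp [hι, hl, add_one_mul], fun a ha => ?_⟩
    have commute_ax := commute_x a fun l' hl' => ha l' (Finset.mem_insert_of_mem hl')
    exact Sum.forall.2 ⟨commute_ax, fun j =>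
      (commute_of_mem_adjoin_range commute_ax hx.chirality_mem_adjoin).mul_right
        (ha l (Finset.mem_insert_self l t) j)⟩

end CommutingFamilies

section TensorModels

variable (k : ℕ)

lemma exists_isHomogeneousChiralSystem_m2PowerGrading :
    ∃ (ι : Type) (_ : Fintype ι) (ε : ι → ℝ) (x : ι → M2Power k) (ω : M2Power k),
      IsHomogeneousChiralSystem (m2PowerGrading k) ε x ω 1 ∧ Fintype.card ι = 2 * k := by
  have factor (l : Fin k) := isHomogeneousChiralSystem_sylvester.toIsChiralSystem.map
    (PiTensorProduct.singleAlgHom (R := ℝ) (A := fun _ => Matrix (Fin 2) (Fin 2) ℝ) l)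
  obtain ⟨ι, _, ε, x, ω, h, hι, -⟩ := exists_isHomogeneousChiralSystem_prod
    (fun l => ⟨factor l,
      fun i => isHomogeneousElem_singleAlgHom l (isHomogeneousChiralSystem_sylvester.homogeneous i),
      isHomogeneousElem_singleAlgHom l isHomogeneousChiralSystem_sylvester.chirality_homogeneous⟩)
    (fun _ _ hl _ _ => commute_singleAlgHom hl _ _) Finset.univ
  exact ⟨ι, _, ε, x, ω, by simpa using h, by simp [hι, mul_comm]⟩

instance M2Power.nontrivial : Nontrivial (M2Power k) :=
  Module.nontrivial_of_finrank_pos (R := ℝ) (by rw [finrank_m2Power]; positivity)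

lemma finrank_zmod_two_prod : Module.finrank (ZMod 2) (Fin k → ZMod 2 × ZMod 2) = 2 * k := by
  simp [Module.finrank_pi_fintype, mul_comm]

lemma hasAnticommPresentation_m2PowerGrading :
    HasAnticommPresentation (firstNegative (2 * k) k) (m2PowerGrading k) := by
  obtain ⟨ι, _, ε, x, ω, h, hι⟩ := exists_isHomogeneousChiralSystem_m2PowerGrading k
  exact h.hasAnticommPresentation hι (two_mul k).symm (by simp) finrank_m2Power
    (finrank_zmod_two_prod k) isPrincipal_m2PowerGrading

lemma hasAnticommPresentation_tensorGrading :
    HasAnticommPresentation (firstNegative (2 * (k + 1)) (k + 2))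
      (tensorGrading (m2PowerGrading k) quaternionGrading) := by
  obtain ⟨ι, _, ε, x, ω, h, hι⟩ := exists_isHomogeneousChiralSystem_m2PowerGrading k
  refine (h.tensorProduct isHomogeneousChiralSystem_quaternion).hasAnticommPresentation (m := k)
    (by simp [hι, mul_add]) (by ring) (by push_cast; ring) ?_ ?_
    (isPrincipal_tensorGrading isPrincipal_m2PowerGrading fun _ => ⟨_, rfl⟩)
  · rw [Module.finrank_tensorProduct, finrank_m2Power, Quaternion.finrank_eq_four]
    ring
  · rw [Module.finrank_prod, finrank_zmod_two_prod, Module.finrank_prod, Module.finrank_self,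
      mul_add_one]

end TensorModels

theorem mainTheorem3 :
    -- classification of fine division gradings on central simple real algebras
    (∀ (G : Type u) [AddCommGroup G] [DecidableEq G] (R : Type v) [Ring R] [Algebra ℝ R]
        [FiniteDimensional ℝ R] [Algebra.IsCentral ℝ R] [IsSimpleRing R]
        (𝒜 : G → Submodule ℝ R) [GradedAlgebra 𝒜],
        AddSubgroup.closure (gradingSupport 𝒜) = ⊤ →
        IsDivisionGrading 𝒜 → IsFineGrading 𝒜 →
        (∀ g : G, Module.finrank ℝ (𝒜 g) = 1) ∧
        (∀ g : G, g + g = 0) ∧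
        ((∃ k : ℕ, GradingEquivalent 𝒜 (cliffGrading k k) ∧
            HasAnticommPresentation (firstNegative (2 * k) k) 𝒜) ∨
          (∃ k : ℕ, 1 ≤ k ∧ GradingEquivalent 𝒜 (cliffGrading (k + 1) (k - 1)) ∧
            HasAnticommPresentation (firstNegative (2 * k) (k + 1)) 𝒜))) ∧
    -- the first family
    (∀ k : ℕ,
        Nonempty (GradedAlgebra (cliffGrading k k)) ∧
        IsDivisionGrading (cliffGrading k k) ∧
        IsFineGrading (cliffGrading k k) ∧
        (∀ g, Module.finrank ℝ (cliffGrading k k g) = 1) ∧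
        Nonempty (Cliff k k ≃ₐ[ℝ] Matrix (Fin (2 ^ k)) (Fin (2 ^ k)) ℝ) ∧
        GradingEquivalent (cliffGrading k k) (m2PowerGrading k) ∧
        HasAnticommPresentation (firstNegative (2 * k) k) (cliffGrading k k)) ∧
    -- the second family
    (∀ k : ℕ, 1 ≤ k →
        Nonempty (GradedAlgebra (cliffGrading (k + 1) (k - 1))) ∧
        IsDivisionGrading (cliffGrading (k + 1) (k - 1)) ∧
        IsFineGrading (cliffGrading (k + 1) (k - 1)) ∧
        (∀ g, Module.finrank ℝ (cliffGrading (k + 1) (k - 1) g) = 1) ∧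
        Nonempty (Cliff (k + 1) (k - 1) ≃ₐ[ℝ]
          Matrix (Fin (2 ^ (k - 1))) (Fin (2 ^ (k - 1))) ℍ[ℝ]) ∧
        GradingEquivalent (cliffGrading (k + 1) (k - 1))
          (tensorGrading (m2PowerGrading (k - 1)) quaternionGrading) ∧
        HasAnticommPresentation (firstNegative (2 * k) (k + 1)) (cliffGrading (k + 1) (k - 1))) := by
  refine ⟨fun G _ _ R _ _ _ _ _ 𝒜 _ hs hd hf => ?_, fun k => ?_, fun k hk => ?_⟩
  · have h0 := hf.zero_le_one hd hs
    have hu := hd.exists_unit_mem hs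
    refine ⟨fun g => (hu g).elim fun _ => finrank_eq_one_of_unit_mem h0,
      fun g => (hu g).elim fun _ => hd.add_self_eq_zero h0, ?_⟩
    obtain ⟨k, h | ⟨hk, h⟩⟩ := hd.exists_hasAnticommPresentation h0 hu
    · exact .inl ⟨k, h.gradingEquivalent (hasAnticommPresentation_cliffGrading (by lia) (by simp)),
        h⟩
    · exact .inr ⟨k, hk,
        h.gradingEquivalent (hasAnticommPresentation_cliffGrading (by lia) (by simp)), h⟩
  · have h := hasAnticommPresentation_cliffGrading (two_mul k).symm (even_two_mul k)
    exact ⟨nonempty_gradedAlgebra_cliffGrading ⟨k, rfl⟩, isDivisionGrading_cliffGrading k k,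
      isFineGrading_of_finrank_eq_one (finrank_cliffGrading k k), finrank_cliffGrading k k,
      nonempty_cliff_algEquiv_matrix k,
      h.gradingEquivalent (hasAnticommPresentation_m2PowerGrading k), h⟩
  · obtain ⟨k, rfl⟩ := Nat.exists_eq_add_of_le' hk
    have h := hasAnticommPresentation_cliffGrading (p := k + 2) (m := k) (n := 2 * (k + 1))
      (by ring) (even_two_mul _)
    exact ⟨nonempty_gradedAlgebra_cliffGrading ⟨k + 1, by simp; ring⟩,
      isDivisionGrading_cliffGrading _ _,
      isFineGrading_of_finrank_eq_one (finrank_cliffGrading _ _), finrank_cliffGrading _ _,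
      nonempty_cliff_algEquiv_matrix_quaternion k,
      h.gradingEquivalent (hasAnticommPresentation_tensorGrading k), h⟩
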